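/- **Theorem.** Let $n$ be a positive integer and let $z\in\mathcal I_n=\{w\in S_n: w=w^{-1}\}$. Then $$\mathcal{ID}^+(z)=\{E:\hat D_{\rm bot}(z)\le_{\mathcal{ID}}E\}=\{E:\hat D_{\rm bot}(z)\sim_{\mathcal{ID}}E\},$$ and this set is also the connected component of $\hat D_{\rm bot}(z)$ (the set of all $E$ that can be joined to it by a finite sequence of ladder moves of the two kinds below and their inverses). Thus $\mathcal{ID}^+(z)$ is an upper and a lower set of $\le_{\mathcal{ID}}$, with unique minimum $\hat D_{\rm bot}(z)$. Moreover, with $T_n=\{(j,i)\in[n]\times[n]: i\le j\}$, $$\mathcal{ID}(z)=\{E\subseteq T_n:\hat D_{\rm bot}(z)\le_{\mathcal{ID}}E\}=\{E\subseteq T_n:\hat D_{\rm bot}(z)\sim_{\mathcal{ID}}E\},$$ and the same holds with the connected component in place of $\sim_{\mathcal{ID}}$. The notation is as follows; $E$ ranges over subsets of $\mathbb Z_{>0}\times\mathbb Z_{>0}$, whose elements $(i,j)$ are read as positions in row $i$ and column $j$ of a matrix. *Atoms.* Let $s_i=(i,i+1)\in S_n$ for $1\le i<n$, let $\ell(w)$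 be the length of a shortest word in the $s_i$ with product $w$, and let $\circ$ be the Demazure product, i.e. the unique associative operation on $S_n$ with $s_i\circ s_i=s_i$ and $v\circ w=vw$ whenever $\ell(vw)=\ell(v)+\ell(w)$. Then $\mathcal A(z)$ is the set of elements $w$ of minimal length with $w^{-1}\circ w=z$. *Pipe dreams.* For $D\subseteq\{(i,j)\in[n]\times[n]:i+j\le n\}$, form the wiring diagram in which each cell of $D$ is a crossing of a horizontal and a vertical path, each other cell with $i+j\le n$ consists of two paths bending away from each other (one joining the left and top sides, one joining the bottom and right sides), and each cell with $i+j=n+1$ is a single path joining its left and top sides. This gives $n$ pipes. $D$ is a reduced pipe dream if no two pipes cross more than once; it belongs to $\mathcal{PD}(w)$, for $w\in S_n$, if moreover for every $i\in[n]$ the pipe with left endpoint in row $i$ has its top endpoint in column $w(i)$. Put $\mathcal{ID}^+(z)=\bigcup_{w\in\mathcal A(z)}\mathcal{PD}(w)$. A reduced pipe dream $D$ is almost-symmetric if for all $i<j$: $(i,j)\in D$ implies $(j,i)\in D$; and if $(j,i)\in D$ but $(i,j)\notin D$, then the two pipes crossing at $(j,i)$ are also the two pipes that avoid each other at $(i,j)$.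 Put $\mathcal{ID}(z)=\{D\cap T_n: D\in\mathcal{PD}(z)\text{ almost-symmetric}\}$. *Ladder moves.* For subsets $D,E$ of $\mathbb Z_{>0}\times\mathbb Z_{>0}$ write $D\lessdot_{\mathcal{PD}}E$ if for some $i<j$ and $k$ one has $\{i+1,\dots,j-1\}\times\{k,k+1\}\subset D$; $(j,k)\in D$; $(i,k),(i,k+1),(j,k+1)\notin D$; and $E=(D\setminus\{(j,k)\})\cup\{(i,k+1)\}$. Write $D\lessdot_{\mathcal{ID}}E$ if for some $i<j$ and $k$ one has $\{i+1,\dots,j-1\}\times\{k,k+1\}\subset D$; $(i,k),(j,k)\in D$; $(i,k+1),(i,k+2),(j,k+1)\notin D$; $E=(D\setminus\{(j,k)\})\cup\{(i,k+1)\}$; and $D$ contains no position strictly northeast of and in the same antidiagonal as $(i,k-1)$, $(i,k)$, $(i,k+1)$ or $(i,k+2)$. Let $\le_{\mathcal{ID}}$ be the reflexive transitive closure of the union of $\lessdot_{\mathcal{PD}}$ and $\lessdot_{\mathcal{ID}}$, and let $\sim_{\mathcal{ID}}$ be the symmetric closure of $\le_{\mathcal{ID}}$. *Bottom involution pipe dream.*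 Let $\hat c_i(z)$ be the number of $j>i$ with $z(i)>z(j)$ and $i\ge z(j)$, and put $\hat D_{\rm bot}(z)=\{(i,j)\in[n]\times[n]: j\le\hat c_i(z)\}$. -/

import Mathlib

/-!
Involution pipe dreams and (involution) ladder moves.

All indices start at `0`: the position in row `i` and column `j` (matrix coordinates, `i, j ≥ 1`) is the pair `(i - 1, j - 1) : ℕ × ℕ`, and `S_n` is `Equiv.Perm (Fin n)`, where the
product is composition of functions.
-/

namespace InvPipeDream

open Equiv

/-! ### Words, length, Demazure product, atoms -/

/-- The simple transposition exchanging two consecutive elements `i` and `i + 1` of `Fin n`. -/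
def simple {n : ℕ} (i : Fin (n - 1)) : Perm (Fin n) :=
  swap ⟨i, by omega⟩ ⟨i + 1, by omega⟩

/-- The product `s_{a_1} s_{a_2} ⋯ s_{a_l}` of the simple transpositions named by a word. -/
def wordProd {n : ℕ} (a : List (Fin (n - 1))) : Perm (Fin n) :=
  (a.map simple).prod

/-- `a` is a reduced word for `w`: a word with product `w` of minimal length. -/
def IsReducedWord {n : ℕ} (a : List (Fin (n - 1))) (w : Perm (Fin n)) : Prop :=
  wordProd a = w ∧ ∀ b : List (Fin (n - 1)), wordProd b = w → a.length ≤ b.length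

theorem exists_wordProd {n : ℕ} (w : Perm (Fin n)) :
    ∃ a : List (Fin (n - 1)), wordProd a = w := by
  cases n with
  | zero => exact ⟨[], Subsingleton.elim _ _⟩
  | succ m =>
    have hw : w ∈ Submonoid.closure
        (Set.range fun i : Fin m => swap i.castSucc i.succ) := by
      rw [Perm.mclosure_swap_castSucc_succ]; trivial
    induction hw using Submonoid.closure_induction with
    | mem x hx =>
      obtain ⟨i, rfl⟩ := hx
      exact ⟨[i], by simp [wordProd, simple]; rfl⟩
    | one => exact ⟨[], rfl⟩
    | mul x y _ _ hx hy =>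
      obtain ⟨a, rfl⟩ := hx
      obtain ⟨b, rfl⟩ := hy
      exact ⟨a ++ b, by simp [wordProd]⟩

theorem exists_isReducedWord {n : ℕ} (w : Perm (Fin n)) :
    ∃ a : List (Fin (n - 1)), IsReducedWord a w := by
  classical
  have h : ∃ l, ∃ a : List (Fin (n - 1)), wordProd a = w ∧ a.length = l := by
    obtain ⟨a, ha⟩ := exists_wordProd w
    exact ⟨_, a, ha, rfl⟩
  obtain ⟨a, ha, hl⟩ := Nat.find_spec h
  exact ⟨a, ha, fun b hb => hl ▸ Nat.find_min' h ⟨b, hb, rfl⟩⟩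

/-- A chosen reduced word for `w`. -/
noncomputable def reducedWord {n : ℕ} (w : Perm (Fin n)) : List (Fin (n - 1)) :=
  (exists_isReducedWord w).choose

/-- The length `ℓ(w)`: the common length of all reduced words for `w`. -/
noncomputable def len {n : ℕ} (w : Perm (Fin n)) : ℕ := (reducedWord w).length

/-- The Demazure product `v ∘ s_i`: it is `v s_i` if `v(i) < v(i+1)`, that is, if
multiplication by `s_i` increases the length, and `v` otherwise. -/
def demazureSimple {n : ℕ} (v : Perm (Fin n)) (i : Fin (n - 1)) : Perm (Fin n) :=
  if v ⟨i, by omega⟩ < v ⟨i + 1, by omega⟩ then v * simple i else v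

/-- The Demazure product `v ∘ w = v ∘ s_{a_1} ∘ ⋯ ∘ s_{a_l}`, where `a_1 ⋯ a_l` is a reduced word
for `w` (the result does not depend on which one). -/
noncomputable def demazure {n : ℕ} (v w : Perm (Fin n)) : Perm (Fin n) :=
  (reducedWord w).foldl demazureSimple v

/-- The set `𝒜(z)` of atoms of `z`: the permutations `w` of minimal length with
`w⁻¹ ∘ w = z`. -/
def atoms {n : ℕ} (z : Perm (Fin n)) : Set (Perm (Fin n)) :=
  {w | demazure w⁻¹ w = z ∧ ∀ v : Perm (Fin n), demazure v⁻¹ v = z → len w ≤ len v}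

/-! ### Wiring diagrams and pipe dreams -/

/-- The side through which a pipe, followed from its left endpoint towards the top, enters a cell. -/
inductive Side where
  | west
  | south

/-- `Enters D p c s`: in the wiring diagram of `D`, the pipe with left endpoint in row `p`, followed
from that endpoint, enters the cell `c` through its side `s`. A cell of `D` is a crossing tile: a
pipe runs straight through it, from west to east or from south to north. Any other cell is a
bending tile: a pipe runs from west to north or from south to east. Cells on and beyond the main
antidiagonal are treated as bending tiles. -/
inductive Enters (D : Set (ℕ × ℕ)) (p : ℕ) : ℕ × ℕ → Side → Prop
  | start : Enters D p (p, 0) Side.west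
  | cross_west {i j : ℕ} : (i, j) ∈ D → Enters D p (i, j) Side.west →
      Enters D p (i, j + 1) Side.west
  | cross_south {i j : ℕ} : (i + 1, j) ∈ D → Enters D p (i + 1, j) Side.south →
      Enters D p (i, j) Side.south
  | bend_west {i j : ℕ} : (i + 1, j) ∉ D → Enters D p (i + 1, j) Side.west →
      Enters D p (i, j) Side.south
  | bend_south {i j : ℕ} : (i, j) ∉ D → Enters D p (i, j) Side.south →
      Enters D p (i, j + 1) Side.west

/-- The pipe with left endpoint `p` leaves the diagram at the top of column `q`. -/
def HasTopEndpoint (D : Set (ℕ × ℕ)) (p q : ℕ) : Prop :=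
  ((0, q) ∈ D ∧ Enters D p (0, q) Side.south) ∨ ((0, q) ∉ D ∧ Enters D p (0, q) Side.west)

/-- The pipe with left endpoint `p` passes through the cell `c`. -/
def PassesThrough (D : Set (ℕ × ℕ)) (p : ℕ) (c : ℕ × ℕ) : Prop :=
  ∃ s, Enters D p c s

/-- The pipes with left endpoints `p` and `q` cross in the cell `c`. -/
def CrossAt (D : Set (ℕ × ℕ)) (p q : ℕ) (c : ℕ × ℕ) : Prop :=
  c ∈ D ∧ ((Enters D p c Side.west ∧ Enters D q c Side.south) ∨
    (Enters D q c Side.west ∧ Enters D p c Side.south))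

/-- The triangle of cells strictly above the main antidiagonal of an `n × n` matrix
(`i + j ≤ n` in one-based coordinates). -/
def upperTriangle (n : ℕ) : Set (ℕ × ℕ) := {c | c.1 + c.2 + 2 ≤ n}

/-- The cells of an `n × n` matrix weakly below the main diagonal. -/
def lowerTriangle (n : ℕ) : Set (ℕ × ℕ) := {c | c.1 < n ∧ c.2 ≤ c.1}

/-- `D` is a reduced pipe dream (of size `n`): no two pipes cross more than once. -/
def IsReducedPipeDream (n : ℕ) (D : Set (ℕ × ℕ)) : Prop :=
  D ⊆ upperTriangle n ∧
    ∀ p q : Fin n, p ≠ q → ∀ c c' : ℕ × ℕ, CrossAt D p q c → CrossAt D p q c' → c = c'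

/-- `𝒫𝒟(w)`: the reduced pipe dreams in which the pipe with left endpoint `p` has top endpoint
`w p`, for every `p`. -/
def PD {n : ℕ} (w : Perm (Fin n)) : Set (Set (ℕ × ℕ)) :=
  {D | IsReducedPipeDream n D ∧ ∀ p : Fin n, HasTopEndpoint D p (w p)}

/-- The almost-symmetry condition on a reduced pipe dream `D` of size `n`. For a position `(j, i)`
in `D` such that `(i, j)` is not, exactly two pipes pass through each of the two cells, crossing
at `(j, i)` and avoiding each other at `(i, j)`; these pairs of pipes have to coincide. -/
def IsAlmostSymmetric (n : ℕ) (D : Set (ℕ × ℕ)) : Prop :=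
  (∀ i j : ℕ, i < j → (i, j) ∈ D → (j, i) ∈ D) ∧
    ∀ i j : ℕ, i < j → (j, i) ∈ D → (i, j) ∉ D →
      ∀ p : Fin n, PassesThrough D p (j, i) ↔ PassesThrough D p (i, j)

/-- `ℐ𝒟(z)`: the involution pipe dreams for `z`. -/
def ID {n : ℕ} (z : Perm (Fin n)) : Set (Set (ℕ × ℕ)) :=
  {E | ∃ D ∈ PD z, IsAlmostSymmetric n D ∧ E = D ∩ lowerTriangle n}

/-- `ℐ𝒟⁺(z)`: the reduced pipe dreams of all atoms of `z`. -/
def IDPlus {n : ℕ} (z : Perm (Fin n)) : Set (Set (ℕ × ℕ)) :=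
  ⋃ w ∈ atoms z, PD w

/-! ### Ladder moves -/

/-- `E` is obtained from `D` by an ordinary ladder move. -/
def LadderMove (D E : Set (ℕ × ℕ)) : Prop :=
  ∃ i j k : ℕ, i < j ∧
    (∀ r, i < r → r < j → (r, k) ∈ D ∧ (r, k + 1) ∈ D) ∧
    (j, k) ∈ D ∧ (i, k) ∉ D ∧ (i, k + 1) ∉ D ∧ (j, k + 1) ∉ D ∧
    E = (D \ {(j, k)}) ∪ {(i, k + 1)}

/-- `E` is obtained from `D` by an involution ladder move. The last condition says that `D` has no
position strictly northeast of, and in the same antidiagonal as, one of `(i, k - 1)`, `(i, k)`,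
`(i, k + 1)`, `(i, k + 2)`; these are the cells `(a, b)` with `a < i` for which `a + b` is one of
`i + k - 1`, `i + k`, `i + k + 1`, `i + k + 2`. -/
def InvLadderMove (D E : Set (ℕ × ℕ)) : Prop :=
  ∃ i j k : ℕ, i < j ∧
    (∀ r, i < r → r < j → (r, k) ∈ D ∧ (r, k + 1) ∈ D) ∧
    (i, k) ∈ D ∧ (j, k) ∈ D ∧ (i, k + 1) ∉ D ∧ (i, k + 2) ∉ D ∧ (j, k + 1) ∉ D ∧
    E = (D \ {(j, k)}) ∪ {(i, k + 1)} ∧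
    ∀ a b : ℕ, a < i → i + k ≤ a + b + 1 → a + b ≤ i + k + 2 → (a, b) ∉ D

/-- One ladder move of either kind. -/
def Move (D E : Set (ℕ × ℕ)) : Prop := LadderMove D E ∨ InvLadderMove D E

/-- The order `≤_ℐ𝒟` generated by ordinary and involution ladder moves. -/
def InvLE : Set (ℕ × ℕ) → Set (ℕ × ℕ) → Prop := Relation.ReflTransGen Move

/-! ### The bottom involution pipe dream -/

/-- The involution code: `ĉ_i(z)` is the number of `j > i` with `z(i) > z(j)` and `i ≥ z(j)`. -/
def invCode {n : ℕ} (z : Perm (Fin n)) (i : Fin n) : ℕ :=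
  (Finset.univ.filter fun j : Fin n => i < j ∧ z j < z i ∧ z j ≤ i).card

/-- The bottom involution pipe dream `D̂_bot(z)`: the first `ĉ_i(z)` cells of each row `i`. -/
def bottom {n : ℕ} (z : Perm (Fin n)) : Set (ℕ × ℕ) :=
  {c | ∃ i j : Fin n, c = (↑i, ↑j) ∧ (j : ℕ) < invCode z i}

end InvPipeDream

namespace InvPipeDream

open Equiv

/-! ### Demazure actions on permutations of `ℕ` -/

/-! A set of cells is encoded by its word: rows are read from top to bottom, each from right to
left, and a cell contributes the index of its antidiagonal. Demazure conjugation `act` by `s` sends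
an involution `y` to `s y s`, to `y s` if `s` exchanges two fixed points of `y`, or leaves it
unchanged at a descent. The reduced words of the atoms of `z` are the words leading from `1` to `z`
in which every letter has an effect (`mem_atoms_iff`). Each effective letter raises `rank` by
exactly 4, so these are also the shortest words leading to `z`, and membership in `IDPlus z` depends
only on the effect and the length of the word.

A ladder move changes neither. Read backwards, it drops `(i, k + 1)` to `(j, k)`, and the letter of
that cell passes the full rows in between by braid relations (`foldl_act_drop`). In an involution
move the letter first has to pass that of `(i, k)`. The empty antidiagonals guarantee that the
involution reached by then fixes the three points concerned, and from such an involution the two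
letters may be applied in either order (`act_act_comm_of_fixed`). An occupied target cell would
absorb the letter, against minimality of length (`notMem_of_canDrop`).

Hence `IDPlus z` is closed under moves and their inverses. Inverse moves raise the sum of the row
indices, so everything reduces to the claim that a member without inverse moves is `bottom z`
(`eq_bottom`). Such a set is left-justified, and no row reaches far beyond the earlier ones. The
involutions produced by the first rows of such a set have an explicit shape (`Upper`); adding a row
carries one exceptional point leftwards (`Carry`), and the row lengths reappear as the involution
code. Undoing the process row by row shows that `bottom z` itself belongs to `IDPlus z`.

For `ID z`, the strictly upper cells are read in the order opposite to that of their transposes. The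
lower cells read so far, preceded by their transposes, then spell the involution they reach: a new
cell multiplies on the right alone if its two points are fixed, and on both sides otherwise. For a
reduced pipe dream, almost-symmetry says that the transpose is missing exactly in the first case
(`commutes_iff_passesThrough`). So `ID z` is the part of `IDPlus z` inside the lower triangle. -/

/-- The simple transposition of `ℕ` exchanging `i` and `i + 1`. -/
def adj (i : ℕ) : Perm ℕ := swap i (i + 1)

theorem adj_apply (i m : ℕ) : adj i m = if m = i then i + 1 else if m = i + 1 then i else m :=
  swap_apply_def i (i + 1) m

@[simp] theorem adj_left (i : ℕ) : adj i i = i + 1 := swap_apply_left _ _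

@[simp] theorem adj_right (i : ℕ) : adj i (i + 1) = i := swap_apply_right _ _

theorem adj_of_ne {i m : ℕ} (h : m ≠ i) (h' : m ≠ i + 1) : adj i m = m :=
  swap_apply_of_ne_of_ne h h'

@[simp] theorem adj_mul_self (i : ℕ) : adj i * adj i = 1 := swap_mul_self _ _

@[simp] theorem adj_inv (i : ℕ) : (adj i)⁻¹ = adj i := swap_inv _ _

@[simp] theorem adj_adj (i m : ℕ) : adj i (adj i m) = m := by
  rw [← Perm.mul_apply, adj_mul_self, Perm.one_apply]

theorem adj_lt_adj {i x y : ℕ} (h : x < y) (h' : ¬(x = i ∧ y = i + 1)) : adj i x < adj i y := by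
  simp only [adj_apply]
  split_ifs <;> omega

theorem conj_adj (v : Perm ℕ) (j : ℕ) : v * adj j = swap (v j) (v (j + 1)) * v := by
  rw [adj, mul_swap_eq_swap_mul]

/-- The Demazure product `v ∘ s_i`. -/
def rdem (v : Perm ℕ) (i : ℕ) : Perm ℕ := if v i < v (i + 1) then v * adj i else v

/-- The Demazure product `s_i ∘ v`. -/
def ldem (i : ℕ) (v : Perm ℕ) : Perm ℕ := (rdem v⁻¹ i)⁻¹

/-- The Demazure conjugation `s_i ∘ y ∘ s_i`. -/
def act (y : Perm ℕ) (i : ℕ) : Perm ℕ := ldem i (rdem y i)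

theorem rdem_of_lt {v : Perm ℕ} {i : ℕ} (h : v i < v (i + 1)) : rdem v i = v * adj i := if_pos h

theorem rdem_of_not_lt {v : Perm ℕ} {i : ℕ} (h : ¬v i < v (i + 1)) : rdem v i = v := if_neg h

theorem ldem_of_lt {v : Perm ℕ} {i : ℕ} (h : v⁻¹ i < v⁻¹ (i + 1)) : ldem i v = adj i * v := by
  rw [ldem, rdem_of_lt h]; simp

theorem ldem_of_not_lt {v : Perm ℕ} {i : ℕ} (h : ¬v⁻¹ i < v⁻¹ (i + 1)) : ldem i v = v := by
  rw [ldem, rdem_of_not_lt h, inv_inv]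

theorem perm_ne_succ (v : Perm ℕ) (i : ℕ) : v i ≠ v (i + 1) := fun h => by
  have := v.injective h; omega

theorem rdem_descent (v : Perm ℕ) (i : ℕ) : rdem v i (i + 1) < rdem v i i := by
  have := perm_ne_succ v i
  unfold rdem
  split_ifs with h
  · simpa using h
  · omega

theorem rdem_eq_self_iff {v : Perm ℕ} {i : ℕ} : rdem v i = v ↔ v (i + 1) < v i :=
  ⟨fun h => h ▸ rdem_descent v i, fun h => rdem_of_not_lt h.not_gt⟩

/-- The two multiplications interfere only if `v` maps `{j, j + 1}` onto `{i, i + 1}`. If it does so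
increasingly, then `s_i v = v s_j` and both sides equal this product; if decreasingly, neither
multiplication has an effect. -/
theorem ldem_rdem_comm (v : Perm ℕ) (i j : ℕ) : ldem i (rdem v j) = rdem (ldem i v) j := by
  by_cases hj : v j < v (j + 1)
  · rw [rdem_of_lt hj]
    by_cases hi : v⁻¹ i < v⁻¹ (i + 1)
    · rw [ldem_of_lt hi]
      by_cases hc : v j = i ∧ v (j + 1) = i + 1
      · have h1 : v⁻¹ i = j := by rw [← hc.1]; simp
        have h2 : v⁻¹ (i + 1) = j + 1 := by rw [← hc.2]; simp
        rw [ldem_of_not_lt, rdem_of_not_lt, conj_adj, hc.1, hc.2, adj]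
        · simp [hc.1, hc.2]
        · rw [mul_inv_rev, Perm.mul_apply, Perm.mul_apply, h1, h2]; simp
      · have hc' : ¬(v⁻¹ i = j ∧ v⁻¹ (i + 1) = j + 1) := fun h =>
          hc ⟨by rw [← h.1]; simp, by rw [← h.2]; simp⟩
        rw [ldem_of_lt, rdem_of_lt, mul_assoc]
        · exact adj_lt_adj hj hc
        · simpa using adj_lt_adj hi hc'
    · rw [ldem_of_not_lt hi, rdem_of_lt hj, ldem_of_not_lt]
      have hne := perm_ne_succ v⁻¹ i
      have hc : ¬(v⁻¹ (i + 1) = j ∧ v⁻¹ i = j + 1) := fun h => by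
        have h1 : v j = i + 1 := by rw [← h.1]; simp
        have h2 : v (j + 1) = i := by rw [← h.2]; simp
        omega
      have := adj_lt_adj (show v⁻¹ (i + 1) < v⁻¹ i by omega) hc
      simpa using this.le
  · rw [rdem_of_not_lt hj]
    by_cases hi : v⁻¹ i < v⁻¹ (i + 1)
    · rw [ldem_of_lt hi, rdem_of_not_lt]
      have hne := perm_ne_succ v j
      have hc : ¬(v (j + 1) = i ∧ v j = i + 1) := fun h => by
        have h1 : v⁻¹ i = j + 1 := by rw [← h.1]; simp
        have h2 : v⁻¹ (i + 1) = j := by rw [← h.2]; simp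
        omega
      exact (adj_lt_adj (show v (j + 1) < v j by omega) hc).le.not_gt
    · rw [ldem_of_not_lt hi, rdem_of_not_lt hj]

theorem rdem_idem (v : Perm ℕ) (i : ℕ) : rdem (rdem v i) i = rdem v i :=
  rdem_eq_self_iff.2 (rdem_descent v i)

theorem adj_comm {i j : ℕ} (h : i + 2 ≤ j) : adj i * adj j = adj j * adj i := by
  ext m
  simp only [Perm.mul_apply, adj_apply]
  split_ifs <;> omega

theorem adj_braid (i : ℕ) : adj i * adj (i + 1) * adj i = adj (i + 1) * adj i * adj (i + 1) := by
  ext m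
  simp only [Perm.mul_apply, adj_apply]
  split_ifs <;> omega

theorem rdem_comm (v : Perm ℕ) {i j : ℕ} (h : i + 2 ≤ j) :
    rdem (rdem v i) j = rdem (rdem v j) i := by
  have h1 : adj i j = j := adj_of_ne (by omega) (by omega)
  have h2 : adj i (j + 1) = j + 1 := adj_of_ne (by omega) (by omega)
  have h3 : adj j i = i := adj_of_ne (by omega) (by omega)
  have h4 : adj j (i + 1) = i + 1 := adj_of_ne (by omega) (by omega)
  by_cases hi : v i < v (i + 1) <;> by_cases hj : v j < v (j + 1) <;>
    simp [rdem, hi, hj, h1, h2, h3, h4, mul_assoc, adj_comm h]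

theorem rdem_braid (v : Perm ℕ) (i : ℕ) :
    rdem (rdem (rdem v i) (i + 1)) i = rdem (rdem (rdem v (i + 1)) i) (i + 1) := by
  have h1 : adj i (i + 1 + 1) = i + 1 + 1 := adj_of_ne (by omega) (by omega)
  have h2 : adj (i + 1) i = i := adj_of_ne (by omega) (by omega)
  have ha := perm_ne_succ v i
  have hb := perm_ne_succ v (i + 1)
  have hc : v i ≠ v (i + 1 + 1) := fun h => by have := v.injective h; omega
  have hbr := adj_braid i
  simp only [mul_assoc] at hbr
  rcases lt_or_gt_of_ne ha with ha | ha <;> rcases lt_or_gt_of_ne hb with hb | hb <;>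
    rcases lt_or_gt_of_ne hc with hc | hc <;>
    -- Of the eight sign patterns of the three comparisons, two are inconsistent and go to `omega`;
    -- the other six are the relative orders of three values.
    first
    | omega
    | simp [rdem, ha, hb, hc, h1, h2, ha.not_gt, hb.not_gt, hc.not_gt, hbr, mul_assoc]

theorem inv_rdem (v : Perm ℕ) (i : ℕ) : (rdem v i)⁻¹ = ldem i v⁻¹ := by rw [ldem, inv_inv]

theorem ldem_comm (v : Perm ℕ) {i j : ℕ} (h : i + 2 ≤ j) :
    ldem i (ldem j v) = ldem j (ldem i v) := by
  simp only [ldem, inv_inv, rdem_comm _ h]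

theorem ldem_braid (v : Perm ℕ) (i : ℕ) :
    ldem i (ldem (i + 1) (ldem i v)) = ldem (i + 1) (ldem i (ldem (i + 1) v)) := by
  simp only [ldem, inv_inv, rdem_braid]

theorem ldem_idem (v : Perm ℕ) (i : ℕ) : ldem i (ldem i v) = ldem i v := by
  simp only [ldem, inv_inv, rdem_idem]

theorem act_idem (y : Perm ℕ) (i : ℕ) : act (act y i) i = act y i := by
  simp only [act, ← ldem_rdem_comm, rdem_idem, ldem_idem]

theorem act_comm (y : Perm ℕ) {i j : ℕ} (h : i + 2 ≤ j) : act (act y i) j = act (act y j) i := by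
  simp only [act, ← ldem_rdem_comm, rdem_comm _ h, ldem_comm _ h]

theorem act_braid (y : Perm ℕ) (i : ℕ) :
    act (act (act y i) (i + 1)) i = act (act (act y (i + 1)) i) (i + 1) := by
  simp only [act, ← ldem_rdem_comm, rdem_braid, ldem_braid]

/-! ### Demazure conjugation of involutions -/

theorem act_inv {y : Perm ℕ} (hy : y⁻¹ = y) (i : ℕ) : (act y i)⁻¹ = act y i :=
  calc (ldem i (rdem y i))⁻¹ = rdem (rdem y i)⁻¹ i := by rw [ldem, inv_inv]
    _ = ldem i (rdem y i) := by rw [inv_rdem, hy, ldem_rdem_comm]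

theorem act_of_not_lt {y : Perm ℕ} (hy : y⁻¹ = y) {i : ℕ} (h : ¬y i < y (i + 1)) :
    act y i = y := by
  rw [act, rdem_of_not_lt h, ldem_of_not_lt (by rwa [hy])]

theorem act_of_fixed {y : Perm ℕ} (hy : y⁻¹ = y) {i : ℕ} (h : y i = i) (h' : y (i + 1) = i + 1) :
    act y i = y * adj i := by
  rw [act, rdem_of_lt (by omega), ldem_of_not_lt]
  simp [hy, h, h']

theorem act_of_lt {y : Perm ℕ} (hy : y⁻¹ = y) {i : ℕ} (h : y i < y (i + 1))
    (h' : ¬(y i = i ∧ y (i + 1) = i + 1)) : act y i = adj i * y * adj i := by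
  rw [act, rdem_of_lt h, ldem_of_lt, mul_assoc]
  simpa [hy] using adj_lt_adj h h'

theorem invol_apply {y : Perm ℕ} (hy : y⁻¹ = y) (m : ℕ) : y (y m) = m := by
  nth_rewrite 1 [← hy]; simp

theorem foldl_act_inv {y : Perm ℕ} (hy : y⁻¹ = y) (a : List ℕ) :
    (a.foldl act y)⁻¹ = a.foldl act y := by
  induction a generalizing y with
  | nil => exact hy
  | cons x a ih => exact ih (act_inv hy x)

/-- The product of the simple transpositions named by a word. -/
def prodAdj (a : List ℕ) : Perm ℕ := (a.map adj).prod

@[simp] theorem prodAdj_nil : prodAdj [] = 1 := rfl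

@[simp] theorem prodAdj_cons (x : ℕ) (a : List ℕ) : prodAdj (x :: a) = adj x * prodAdj a := by
  simp [prodAdj]

@[simp] theorem prodAdj_append (a b : List ℕ) : prodAdj (a ++ b) = prodAdj a * prodAdj b := by
  simp [prodAdj]

theorem foldl_rdem_ldem (v : Perm ℕ) (i : ℕ) (a : List ℕ) :
    a.foldl rdem (ldem i v) = ldem i (a.foldl rdem v) := by
  induction a generalizing v with
  | nil => rfl
  | cons x a ih => rw [List.foldl_cons, List.foldl_cons, ← ldem_rdem_comm, ih]

/-- Left and right Demazure multiplications commute, so all the right ones may be carried out before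
the left ones. -/
theorem foldl_act_eq (y : Perm ℕ) (a : List ℕ) :
    a.foldl act y = a.foldl (fun v i => ldem i v) (a.foldl rdem y) := by
  induction a generalizing y with
  | nil => rfl
  | cons x a ih => simp only [List.foldl_cons, act, ih, foldl_rdem_ldem]

theorem inv_foldl_rdem (v : Perm ℕ) (a : List ℕ) :
    (a.foldl rdem v)⁻¹ = a.foldl (fun v i => ldem i v) v⁻¹ := by
  induction a generalizing v with
  | nil => rfl
  | cons x a ih => rw [List.foldl_cons, List.foldl_cons, ih, inv_rdem]

theorem foldl_rdem_foldl_ldem (v : Perm ℕ) (a b : List ℕ) :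
    a.foldl rdem (b.foldl (fun v i => ldem i v) v) =
      b.foldl (fun v i => ldem i v) (a.foldl rdem v) := by
  induction b generalizing v with
  | nil => rfl
  | cons x b ih => rw [List.foldl_cons, List.foldl_cons, ih, foldl_rdem_ldem]

/-- `w⁻¹ ∘ w` is obtained by successive Demazure conjugations. -/
theorem foldl_rdem_inv (a : List ℕ) :
    a.foldl rdem (a.foldl rdem 1)⁻¹ = a.foldl act 1 := by
  rw [inv_foldl_rdem, foldl_rdem_foldl_ldem, inv_one, foldl_act_eq]

/-- A right descent at `i` means being fixed by `rdem · i`, a property preserved by every operation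
commuting with `rdem · i`. -/
theorem foldl_ldem_descent {v : Perm ℕ} {i : ℕ} (h : v (i + 1) < v i) (a : List ℕ) :
    a.foldl (fun v i => ldem i v) v (i + 1) < a.foldl (fun v i => ldem i v) v i := by
  induction a generalizing v with
  | nil => exact h
  | cons x a ih =>
    apply ih
    rw [← rdem_eq_self_iff] at h ⊢
    rw [← ldem_rdem_comm, h]

/-! ### Words with the same effect -/

/-- Two words have the same effect by Demazure conjugation. -/
def WEq (a b : List ℕ) : Prop := ∀ y : Perm ℕ, a.foldl act y = b.foldl act y

theorem WEq.refl (a : List ℕ) : WEq a a := fun _ => rfl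

theorem WEq.trans {a b c : List ℕ} (h : WEq a b) (h' : WEq b c) : WEq a c :=
  fun y => (h y).trans (h' y)

theorem WEq.append {a b c d : List ℕ} (h : WEq a b) (h' : WEq c d) : WEq (a ++ c) (b ++ d) :=
  fun y => by rw [List.foldl_append, List.foldl_append, h y, h' _]

theorem WEq.cons_comm {c : ℕ} {a : List ℕ} (h : ∀ x ∈ a, x + 2 ≤ c ∨ c + 2 ≤ x) :
    WEq (c :: a) (a ++ [c]) := by
  induction a with
  | nil => exact .refl _
  | cons x a ih =>
    intro y
    have h1 : act (act y c) x = act (act y x) c := by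
      rcases h x (by simp) with h | h
      · rw [act_comm _ h]
      · rw [act_comm _ h]
    have := ih (fun z hz => h z (by simp [hz])) (act y x)
    simpa [h1] using this

/-! ### Inversions -/

/-- The permutation `v` fixes all `m ≥ n`. -/
def FixesFrom (n : ℕ) (v : Perm ℕ) : Prop := ∀ m, n ≤ m → v m = m

theorem FixesFrom.one (n : ℕ) : FixesFrom n 1 := fun _ _ => rfl

theorem FixesFrom.mul {n : ℕ} {v w : Perm ℕ} (hv : FixesFrom n v) (hw : FixesFrom n w) :
    FixesFrom n (v * w) := fun m hm => by rw [Perm.mul_apply, hw m hm, hv m hm]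

theorem FixesFrom.inv {n : ℕ} {v : Perm ℕ} (hv : FixesFrom n v) : FixesFrom n v⁻¹ :=
  fun m hm => by rw [Perm.inv_eq_iff_eq, hv m hm]

theorem FixesFrom.adj {n i : ℕ} (hi : i + 1 < n) : FixesFrom n (adj i) :=
  fun m hm => adj_of_ne (by omega) (by omega)

theorem FixesFrom.lt {n : ℕ} {v : Perm ℕ} (hv : FixesFrom n v) {m : ℕ} (hm : m < n) :
    v m < n := by
  by_contra h
  have := v.injective (hv (v m) (by omega))
  omega

theorem FixesFrom.rdem {n i : ℕ} {v : Perm ℕ} (hv : FixesFrom n v) (hi : i + 1 < n) :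
    FixesFrom n (rdem v i) := by
  unfold InvPipeDream.rdem
  split_ifs
  exacts [hv.mul (.adj hi), hv]

theorem FixesFrom.act {n i : ℕ} {v : Perm ℕ} (hv : FixesFrom n v) (hi : i + 1 < n) :
    FixesFrom n (act v i) := ((hv.rdem hi).inv.rdem hi).inv

theorem FixesFrom.foldl_act {n : ℕ} {y : Perm ℕ} (hy : FixesFrom n y) {a : List ℕ}
    (ha : ∀ x ∈ a, x + 1 < n) : FixesFrom n (a.foldl InvPipeDream.act y) := by
  induction a generalizing y with
  | nil => exact hy
  | cons x a ih =>
    exact ih (hy.act (ha x (by simp))) fun x hx => ha x (by simp [hx])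

theorem FixesFrom.prodAdj {n : ℕ} {a : List ℕ} (ha : ∀ x ∈ a, x + 1 < n) :
    FixesFrom n (prodAdj a) := by
  induction a with
  | nil => exact .one n
  | cons x a ih =>
    rw [prodAdj_cons]
    exact (FixesFrom.adj (ha x (by simp))).mul (ih fun x hx => ha x (by simp [hx]))

/-- The inversions of `v` in `{0, …, n - 1}`. -/
def inversions (n : ℕ) (v : Perm ℕ) : Finset (ℕ × ℕ) :=
  (Finset.range n ×ˢ Finset.range n).filter fun c => c.1 < c.2 ∧ v c.2 < v c.1

/-- The number of inversions of `v` in `{0, …, n - 1}`. -/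
def invNum (n : ℕ) (v : Perm ℕ) : ℕ := (inversions n v).card

theorem mem_inversions {n : ℕ} {v : Perm ℕ} {a b : ℕ} :
    (a, b) ∈ inversions n v ↔ (a < n ∧ b < n) ∧ a < b ∧ v b < v a := by
  simp [inversions]

theorem adj_lt_iff {n i m : ℕ} (hi : i + 1 < n) : adj i m < n ↔ m < n := by
  rw [adj_apply]; split_ifs <;> omega

/-- Applying `adj i` to both coordinates matches the inversions of `v * adj i` other than `(i, i +
1)` with those of `v`. -/
theorem invNum_mul_adj {n i : ℕ} {v : Perm ℕ} (hi : i + 1 < n) (h : v i < v (i + 1)) :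
    invNum n (v * adj i) = invNum n v + 1 := by
  have hmem : (i, i + 1) ∈ inversions n (v * adj i) := by
    rw [mem_inversions]; simp [h]; omega
  rw [invNum, invNum, ← Finset.card_erase_add_one hmem]
  congr 1
  refine Finset.card_nbij' (fun c => (adj i c.1, adj i c.2)) (fun c => (adj i c.1, adj i c.2))
    ?_ ?_ ?_ ?_
  · rintro ⟨a, b⟩ hc
    simp only [Finset.coe_erase, Set.mem_sdiff, Finset.mem_coe, mem_inversions, Perm.mul_apply,
      Set.mem_singleton_iff, Prod.mk.injEq] at hc ⊢
    exact ⟨by simpa [adj_lt_iff hi] using hc.1.1, adj_lt_adj hc.1.2.1 hc.2, hc.1.2.2⟩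
  · rintro ⟨a, b⟩ hc
    simp only [Finset.coe_erase, Set.mem_sdiff, Finset.mem_coe, mem_inversions, Perm.mul_apply,
      Set.mem_singleton_iff, Prod.mk.injEq, adj_adj] at hc ⊢
    have hne : ¬(a = i ∧ b = i + 1) := by
      rintro ⟨rfl, rfl⟩; omega
    refine ⟨⟨by simpa [adj_lt_iff hi] using hc.1, adj_lt_adj hc.2.1 hne, hc.2.2⟩, ?_⟩
    rintro ⟨h1, h2⟩
    have h1' : a = i + 1 := by rw [← adj_adj i a, h1, adj_left]
    have h2' : b = i := by rw [← adj_adj i b, h2, adj_right]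
    omega
  · intro c _; simp
  · intro c _; simp

theorem invNum_mul_adj_of_gt {n i : ℕ} {v : Perm ℕ} (hi : i + 1 < n) (h : v (i + 1) < v i) :
    invNum n v = invNum n (v * adj i) + 1 := by
  rw [← invNum_mul_adj hi (v := v * adj i) (by simpa using h), mul_assoc, adj_mul_self, mul_one]

theorem invNum_mul_adj_le {n i : ℕ} (v : Perm ℕ) (hi : i + 1 < n) :
    invNum n (v * adj i) ≤ invNum n v + 1 := by
  rcases lt_or_gt_of_ne (perm_ne_succ v i) with h | h
  · exact (invNum_mul_adj hi h).le
  · have := invNum_mul_adj_of_gt hi h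
    omega

theorem lt_of_invNum_mul_adj {n i : ℕ} {v : Perm ℕ} (hi : i + 1 < n)
    (h : invNum n v < invNum n (v * adj i)) : v i < v (i + 1) := by
  by_contra hc
  have := invNum_mul_adj_of_gt hi (lt_of_le_of_ne (not_lt.1 hc) (perm_ne_succ v i).symm)
  omega

theorem invNum_inverse {n : ℕ} {v : Perm ℕ} (hv : FixesFrom n v) : invNum n v⁻¹ = invNum n v := by
  refine Finset.card_nbij' (fun c => (v⁻¹ c.2, v⁻¹ c.1)) (fun c => (v c.2, v c.1)) ?_ ?_ ?_ ?_
  · rintro ⟨a, b⟩ hc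
    simp only [Finset.mem_coe, mem_inversions] at hc ⊢
    refine ⟨⟨hv.inv.lt hc.1.2, hv.inv.lt hc.1.1⟩, hc.2.2, by simpa using hc.2.1⟩
  · rintro ⟨a, b⟩ hc
    simp only [Finset.mem_coe, mem_inversions] at hc ⊢
    refine ⟨⟨hv.lt hc.1.2, hv.lt hc.1.1⟩, hc.2.2, by simpa using hc.2.1⟩
  · intro c _; simp
  · intro c _; simp

theorem invNum_adj_mul {n i : ℕ} {v : Perm ℕ} (hv : FixesFrom n v) (hi : i + 1 < n)
    (h : v⁻¹ i < v⁻¹ (i + 1)) : invNum n (adj i * v) = invNum n v + 1 := by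
  rw [← invNum_inverse ((FixesFrom.adj hi).mul hv), mul_inv_rev, adj_inv, invNum_mul_adj hi h,
    invNum_inverse hv]

theorem invNum_adj_mul_le {n i : ℕ} {v : Perm ℕ} (hv : FixesFrom n v) (hi : i + 1 < n) :
    invNum n (adj i * v) ≤ invNum n v + 1 := by
  rw [← invNum_inverse ((FixesFrom.adj hi).mul hv), mul_inv_rev, adj_inv, ← invNum_inverse hv]
  exact invNum_mul_adj_le _ hi

theorem lt_of_invNum_adj_mul {n i : ℕ} {v : Perm ℕ} (hv : FixesFrom n v) (hi : i + 1 < n)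
    (h : invNum n v < invNum n (adj i * v)) : v⁻¹ i < v⁻¹ (i + 1) := by
  refine lt_of_invNum_mul_adj hi ?_
  rwa [invNum_inverse hv, ← invNum_inverse (hv.inv.mul (.adj hi)), mul_inv_rev, inv_inv, adj_inv]

@[simp] theorem invNum_one (n : ℕ) : invNum n 1 = 0 := by
  rw [invNum, Finset.card_eq_zero, Finset.eq_empty_iff_forall_notMem]
  rintro ⟨a, b⟩ hc
  rw [mem_inversions] at hc
  simp only [Perm.one_apply] at hc
  omega

theorem invNum_mul_prodAdj_le {n : ℕ} (v : Perm ℕ) {a : List ℕ} (ha : ∀ x ∈ a, x + 1 < n) :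
    invNum n (v * prodAdj a) ≤ invNum n v + a.length := by
  induction a generalizing v with
  | nil => simp
  | cons x a ih =>
    have h1 := ih (v * adj x) fun x hx => ha x (by simp [hx])
    have h2 := invNum_mul_adj_le v (ha x (by simp))
    rw [prodAdj_cons, ← mul_assoc, List.length_cons]
    omega

theorem invNum_prodAdj_mul_le {n : ℕ} {v : Perm ℕ} (hv : FixesFrom n v) {a : List ℕ}
    (ha : ∀ x ∈ a, x + 1 < n) : invNum n (prodAdj a * v) ≤ invNum n v + a.length := by
  induction a with
  | nil => simp
  | cons x a ih =>
    have ha' : ∀ x ∈ a, x + 1 < n := fun x hx => ha x (by simp [hx])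
    have h1 := ih ha'
    have h2 := invNum_adj_mul_le ((FixesFrom.prodAdj ha').mul hv) (ha x (by simp))
    rw [prodAdj_cons, mul_assoc, List.length_cons]
    omega

theorem invNum_prodAdj_le {n : ℕ} {a : List ℕ} (ha : ∀ x ∈ a, x + 1 < n) :
    invNum n (prodAdj a) ≤ a.length := by
  simpa using invNum_mul_prodAdj_le 1 ha

/-- A factor of a reduced word is reduced. -/
theorem invNum_prodAdj_infix {n : ℕ} {a b c : List ℕ} (h : ∀ x ∈ a ++ b ++ c, x + 1 < n)
    (hr : invNum n (prodAdj (a ++ b ++ c)) = (a ++ b ++ c).length) :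
    invNum n (prodAdj b) = b.length := by
  have ha : ∀ x ∈ a, x + 1 < n := fun x hx => h x (by simp [hx])
  have hb : ∀ x ∈ b, x + 1 < n := fun x hx => h x (by simp [hx])
  have hc : ∀ x ∈ c, x + 1 < n := fun x hx => h x (by simp [hx])
  -- Each factor contributes at most its length to the inversion number, so equality for the product
  -- forces equality for `b`.
  have h1 := invNum_mul_prodAdj_le (prodAdj (a ++ b)) hc
  have h2 := invNum_prodAdj_mul_le (FixesFrom.prodAdj hb) ha
  have h3 := invNum_prodAdj_le hb
  rw [prodAdj_append, prodAdj_append] at hr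
  rw [prodAdj_append] at h1
  simp only [List.length_append] at hr
  omega

theorem eq_one_of_forall_lt {v : Perm ℕ} (h : ∀ i, v i < v (i + 1)) : v = 1 := by
  have hm : StrictMono v := strictMono_nat_of_lt_succ h
  have := Subsingleton.elim (hm.orderIsoOfSurjective v v.surjective) (OrderIso.refl ℕ)
  ext m
  have := congrArg (fun f : ℕ ≃o ℕ => f m) this
  simpa using this

theorem FixesFrom.exists_descent {n : ℕ} {v : Perm ℕ} (hv : FixesFrom n v) (h1 : v ≠ 1) :
    ∃ i, i + 1 < n ∧ v (i + 1) < v i := by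
  by_contra! hc
  refine h1 (eq_one_of_forall_lt fun i => ?_)
  by_cases hi : i + 1 < n
  · exact lt_of_le_of_ne (hc i hi) (perm_ne_succ v i)
  · rw [hv (i + 1) (by omega)]
    by_cases hi' : i < n
    · have := hv.lt hi'
      omega
    · rw [hv i (by omega)]; omega

theorem exists_prodAdj {n : ℕ} {v : Perm ℕ} (hv : FixesFrom n v) :
    ∃ a : List ℕ, (∀ x ∈ a, x + 1 < n) ∧ prodAdj a = v ∧ a.length = invNum n v := by
  induction h : invNum n v generalizing v with
  | zero =>
    by_cases h1 : v = 1
    · exact ⟨[], by simp, h1.symm, rfl⟩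
    · obtain ⟨i, hi, hd⟩ := hv.exists_descent h1
      have := invNum_mul_adj_of_gt hi hd
      omega
  | succ k ih =>
    have h1 : v ≠ 1 := by rintro rfl; simp at h
    obtain ⟨i, hi, hd⟩ := hv.exists_descent h1
    have := invNum_mul_adj_of_gt hi hd
    obtain ⟨a, ha, hp, hl⟩ := ih (hv.mul (.adj hi)) (by omega)
    refine ⟨a ++ [i], ?_, ?_, by simp [hl]⟩
    · simp only [List.mem_append, List.mem_singleton]
      rintro x (hx | rfl)
      exacts [ha x hx, hi]
    · rw [prodAdj_append, hp]; simp [mul_assoc]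

theorem foldl_rdem_of_reduced {n : ℕ} {a : List ℕ} (ha : ∀ x ∈ a, x + 1 < n)
    (hr : invNum n (prodAdj a) = a.length) : a.foldl rdem 1 = prodAdj a := by
  induction a using List.reverseRecOn with
  | nil => rfl
  | append_singleton a x ih =>
    have ha' : ∀ x ∈ a, x + 1 < n := fun x hx => ha x (by simp [hx])
    have hx : x + 1 < n := ha x (by simp)
    have h1 := invNum_prodAdj_le ha'
    have h2 := invNum_mul_adj_le (prodAdj a) hx
    have h3 : invNum n (prodAdj a * adj x) = a.length + 1 := by simpa using hr
    rw [List.foldl_append, ih ha' (by omega)]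
    have : prodAdj a x < prodAdj a (x + 1) := lt_of_invNum_mul_adj hx (by omega)
    simp [rdem_of_lt this]

/-! ### Ascending words of involutions -/

/-- Every Demazure conjugation of `y` by the letters of the word, in turn, has an effect. -/
def Ascending : Perm ℕ → List ℕ → Prop
  | _, [] => True
  | y, x :: a => y x < y (x + 1) ∧ Ascending (act y x) a

theorem ascending_append {y : Perm ℕ} {a b : List ℕ} :
    Ascending y (a ++ b) ↔ Ascending y a ∧ Ascending (a.foldl act y) b := by
  induction a generalizing y with
  | nil => simp [Ascending]
  | cons x a ih => simp [Ascending, ih, and_assoc]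

/-- Twice the number of inversions plus the number of non-fixed points. -/
def rank (n : ℕ) (y : Perm ℕ) : ℕ :=
  2 * invNum n y + ((Finset.range n).filter fun m => y m ≠ m).card

theorem rank_one (n : ℕ) : rank n 1 = 0 := by simp [rank]

theorem invNum_act {n i : ℕ} {y : Perm ℕ} (hy : y⁻¹ = y) (hf : FixesFrom n y) (hi : i + 1 < n)
    (h : y i < y (i + 1)) (h' : ¬(y i = i ∧ y (i + 1) = i + 1)) :
    invNum n (adj i * y * adj i) = invNum n y + 2 := by
  rw [mul_assoc, invNum_adj_mul (hf.mul (.adj hi)) hi, invNum_mul_adj hi h]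
  simpa [hy] using adj_lt_adj h h'

/-- Multiplication by a transposition of two fixed points creates one inversion and two moved
points; a proper conjugation creates two inversions and keeps the number of moved points. The
weights 2 and 1 in `rank` make both cases count 4, so that all ascending words between the same
involutions have the same length. -/
theorem rank_act {n i : ℕ} {y : Perm ℕ} (hy : y⁻¹ = y) (hf : FixesFrom n y) (hi : i + 1 < n)
    (h : y i < y (i + 1)) : rank n (act y i) = rank n y + 4 := by
  by_cases h' : y i = i ∧ y (i + 1) = i + 1
  · have hs : (Finset.range n).filter (fun m => (y * adj i) m ≠ m) =
        insert i (insert (i + 1) ((Finset.range n).filter fun m => y m ≠ m)) := by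
      ext m
      rw [Finset.mem_filter, Finset.mem_insert, Finset.mem_insert, Finset.mem_filter,
        Finset.mem_range, Perm.mul_apply]
      rcases eq_or_ne m i with rfl | h1
      · rw [adj_left, h'.2]; simp; omega
      rcases eq_or_ne m (i + 1) with rfl | h2
      · rw [adj_right, h'.1]; simp; omega
      simp [h1, h2, adj_of_ne h1 h2]
    rw [act_of_fixed hy h'.1 h'.2, rank, rank, invNum_mul_adj hi h, hs, Finset.card_insert_of_notMem,
      Finset.card_insert_of_notMem]
    · ring
    · simp [h'.2]
    · simp [h'.1]
  · rw [act_of_lt hy h h', rank, rank, invNum_act hy hf hi h h']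
    have : ((Finset.range n).filter fun m => (adj i * y * adj i) m ≠ m).card =
        ((Finset.range n).filter fun m => y m ≠ m).card := by
      refine Finset.card_nbij' (adj i) (adj i) ?_ ?_ ?_ ?_
      · intro m hm
        rw [Finset.mem_coe, Finset.mem_filter, Finset.mem_range, Perm.mul_apply,
          Perm.mul_apply] at hm
        rw [Finset.mem_coe, Finset.mem_filter, Finset.mem_range]
        refine ⟨(adj_lt_iff hi).2 hm.1, fun hc => hm.2 ?_⟩
        rw [hc, adj_adj]
      · intro m hm
        rw [Finset.mem_coe, Finset.mem_filter, Finset.mem_range] at hm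
        rw [Finset.mem_coe, Finset.mem_filter, Finset.mem_range, Perm.mul_apply,
          Perm.mul_apply, adj_adj]
        exact ⟨(adj_lt_iff hi).2 hm.1, fun hc => hm.2 ((adj i).injective hc)⟩
      · intro m _; simp
      · intro m _; simp
    omega

theorem rank_foldl_act {n : ℕ} {y : Perm ℕ} (hy : y⁻¹ = y) (hf : FixesFrom n y) {a : List ℕ}
    (ha : ∀ x ∈ a, x + 1 < n) :
    rank n (a.foldl act y) ≤ rank n y + 4 * a.length ∧
      (rank n (a.foldl act y) = rank n y + 4 * a.length ↔ Ascending y a) := by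
  induction a generalizing y with
  | nil => simp [Ascending]
  | cons x a ih =>
    have hx : x + 1 < n := ha x (by simp)
    obtain ⟨h1, h2⟩ := ih (act_inv hy x) (hf.act hx) fun x hx => ha x (by simp [hx])
    rw [List.foldl_cons, Ascending, ← h2, List.length_cons]
    by_cases h : y x < y (x + 1)
    · have := rank_act hy hf hx h
      simp only [h, true_and]
      omega
    · rw [act_of_not_lt hy h] at *
      simp only [h, false_and, iff_false]
      omega

theorem rank_foldl_act_one {n : ℕ} {a : List ℕ} (ha : ∀ x ∈ a, x + 1 < n) :
    rank n (a.foldl act 1) ≤ 4 * a.length ∧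
      (rank n (a.foldl act 1) = 4 * a.length ↔ Ascending 1 a) := by
  simpa [rank_one] using rank_foldl_act inv_one (FixesFrom.one n) ha

/-- Letters without effect can be deleted. -/
theorem exists_ascending (y : Perm ℕ) (hy : y⁻¹ = y) (a : List ℕ) :
    ∃ b : List ℕ, (∀ x ∈ b, x ∈ a) ∧ b.foldl act y = a.foldl act y ∧ Ascending y b := by
  induction a generalizing y with
  | nil => exact ⟨[], by simp, rfl, trivial⟩
  | cons x a ih =>
    obtain ⟨b, hb, he, hA⟩ := ih (act y x) (act_inv hy x)
    by_cases h : y x < y (x + 1)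
    · refine ⟨x :: b, ?_, he, h, hA⟩
      simp only [List.mem_cons]
      rintro z (rfl | hz)
      exacts [.inl rfl, .inr (hb z hz)]
    · rw [List.foldl_cons]
      rw [act_of_not_lt hy h] at *
      exact ⟨b, fun z hz => by simp [hb z hz], he, hA⟩

/-- If the last letter were a right descent of the product of the others, it would remain one after
the left multiplications that turn this product into the involution reached, and so it would have no
effect there. -/
theorem Ascending.reduced {n : ℕ} {a : List ℕ} (ha : ∀ x ∈ a, x + 1 < n) (h : Ascending 1 a) :
    invNum n (prodAdj a) = a.length := by
  induction a using List.reverseRecOn with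
  | nil => simp
  | append_singleton a x ih =>
    have ha' : ∀ x ∈ a, x + 1 < n := fun x hx => ha x (by simp [hx])
    rw [ascending_append] at h
    have hr := ih ha' h.1
    have h2 := h.2.1
    rw [prodAdj_append, prodAdj_cons, prodAdj_nil, mul_one, invNum_mul_adj (ha x (by simp)), hr]
    · simp
    · by_contra hc
      have := foldl_ldem_descent (lt_of_le_of_ne (not_lt.1 hc) (perm_ne_succ _ _).symm) a
      rw [foldl_act_eq, foldl_rdem_of_reduced ha' hr] at h2
      exact absurd h2 this.not_gt

/-! ### Permutations of `Fin n` as permutations of `ℕ` -/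

/-- The extension of a permutation of `Fin n` by the identity. -/
def ext {n : ℕ} : Perm (Fin n) →* Perm ℕ := Perm.extendDomainHom Fin.equivSubtype

theorem ext_val {n : ℕ} (w : Perm (Fin n)) (i : Fin n) : ext w i = w i :=
  Perm.extendDomain_apply_image w Fin.equivSubtype i

theorem ext_mk {n : ℕ} (w : Perm (Fin n)) {i : ℕ} (h : i < n) : ext w i = w ⟨i, h⟩ :=
  ext_val w ⟨i, h⟩

theorem fixesFrom_ext {n : ℕ} (w : Perm (Fin n)) : FixesFrom n (ext w) := fun _ hm =>
  Perm.extendDomain_apply_not_subtype w Fin.equivSubtype (by omega)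

theorem ext_injective {n : ℕ} : Function.Injective (ext (n := n)) := fun v w h => by
  ext i
  rw [← ext_val, ← ext_val, h]

theorem ext_simple {n : ℕ} (i : Fin (n - 1)) : ext (simple i) = adj i := by
  ext m
  by_cases hm : m < n
  · rw [ext_mk _ hm, simple, swap_apply_def, adj_apply]
    simp only [Fin.ext_iff]
    split_ifs <;> rfl
  · rw [fixesFrom_ext _ m (by omega), adj_of_ne] <;> omega

theorem ext_wordProd {n : ℕ} (a : List (Fin (n - 1))) :
    ext (wordProd a) = prodAdj (a.map Fin.val) := by
  simp [wordProd, prodAdj, map_list_prod, Function.comp_def, ext_simple]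

theorem forall_letters {n : ℕ} (a : List (Fin (n - 1))) : ∀ x ∈ a.map Fin.val, x + 1 < n := by
  simp only [List.mem_map]
  rintro _ ⟨x, _, rfl⟩
  omega

theorem exists_letters {n : ℕ} {a : List ℕ} (ha : ∀ x ∈ a, x + 1 < n) :
    ∃ b : List (Fin (n - 1)), b.map Fin.val = a := by
  induction a with
  | nil => exact ⟨[], rfl⟩
  | cons x a ih =>
    obtain ⟨b, rfl⟩ := ih fun x hx => ha x (by simp [hx])
    exact ⟨⟨x, by have := ha x (by simp); omega⟩ :: b, rfl⟩

theorem ext_demazureSimple {n : ℕ} (v : Perm (Fin n)) (i : Fin (n - 1)) :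
    ext (demazureSimple v i) = rdem (ext v) i := by
  rw [demazureSimple, rdem, ext_mk v (i := i) (by omega), ext_mk v (i := i + 1) (by omega)]
  simp only [Fin.lt_def]
  split_ifs <;> simp [ext_simple]

theorem ext_foldl_demazureSimple {n : ℕ} (v : Perm (Fin n)) (a : List (Fin (n - 1))) :
    ext (a.foldl demazureSimple v) = (a.map Fin.val).foldl rdem (ext v) := by
  induction a generalizing v with
  | nil => rfl
  | cons x a ih => rw [List.foldl_cons, ih, ext_demazureSimple]; rfl

theorem len_eq {n : ℕ} (w : Perm (Fin n)) : len w = invNum n (ext w) := by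
  obtain ⟨h1, h2⟩ := (exists_isReducedWord w).choose_spec
  apply le_antisymm
  · obtain ⟨a, ha, hp, hl⟩ := exists_prodAdj (fixesFrom_ext w)
    obtain ⟨b, rfl⟩ := exists_letters ha
    rw [← hl, List.length_map]
    exact h2 b (ext_injective (by rw [ext_wordProd, hp]))
  · have := invNum_prodAdj_le (forall_letters (exists_isReducedWord w).choose)
    rwa [← ext_wordProd, h1, List.length_map] at this

theorem foldl_rdem_inv_of_reduced {n : ℕ} {a : List ℕ} (ha : ∀ x ∈ a, x + 1 < n)
    (hr : invNum n (prodAdj a) = a.length) :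
    a.foldl rdem (prodAdj a)⁻¹ = a.foldl act 1 := by
  rw [← foldl_rdem_inv, foldl_rdem_of_reduced ha hr]

theorem ext_demazure {n : ℕ} (w : Perm (Fin n)) :
    ∃ a : List ℕ, (∀ x ∈ a, x + 1 < n) ∧ prodAdj a = ext w ∧ invNum n (ext w) = a.length ∧
      ext (demazure w⁻¹ w) = a.foldl act 1 := by
  have h1 : wordProd (reducedWord w) = w := (exists_isReducedWord w).choose_spec.1
  have h2 := len_eq w
  have ha := forall_letters (reducedWord w)
  have hp : prodAdj ((reducedWord w).map Fin.val) = ext w := by rw [← ext_wordProd, h1]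
  have hl : invNum n (ext w) = ((reducedWord w).map Fin.val).length := by
    rw [← h2, List.length_map]; rfl
  refine ⟨_, ha, hp, hl, ?_⟩
  rw [demazure, ext_foldl_demazureSimple, map_inv, ← hp, foldl_rdem_inv_of_reduced ha]
  rw [hp, hl]

/-- The Demazure product `w⁻¹ ∘ w` can be computed from any reduced word. -/
theorem ext_demazure_eq {n : ℕ} {w : Perm (Fin n)} {a : List ℕ} (ha : ∀ x ∈ a, x + 1 < n)
    (hp : prodAdj a = ext w) (hr : invNum n (ext w) = a.length) :
    ext (demazure w⁻¹ w) = a.foldl act 1 := by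
  obtain ⟨b, hb, hbp, hbl, he⟩ := ext_demazure w
  have h1 : b.foldl rdem 1 = ext w := by rw [foldl_rdem_of_reduced hb (by rw [hbp, hbl]), hbp]
  have h2 : a.foldl rdem 1 = ext w := by rw [foldl_rdem_of_reduced ha (by rw [hp, hr]), hp]
  rw [he, ← foldl_rdem_inv_of_reduced ha (by rw [hp, hr]), hp, ← h1, inv_foldl_rdem, inv_one,
    foldl_rdem_foldl_ldem, h2, foldl_act_eq, h1]

theorem exists_ext_eq_prodAdj {n : ℕ} {a : List ℕ} (ha : ∀ x ∈ a, x + 1 < n) :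
    ∃ w : Perm (Fin n), prodAdj a = ext w := by
  obtain ⟨b, rfl⟩ := exists_letters ha
  exact ⟨wordProd b, (ext_wordProd b).symm⟩

/-- The reduced words of atoms of `z` are the ascending words leading to `z`. -/
theorem mem_atoms_iff {n : ℕ} {z w : Perm (Fin n)} {a : List ℕ} (ha : ∀ x ∈ a, x + 1 < n)
    (hp : prodAdj a = ext w) (hr : invNum n (ext w) = a.length) :
    w ∈ atoms z ↔ a.foldl act 1 = ext z ∧ Ascending 1 a := by
  rw [atoms, Set.mem_ofPred_eq, ← ext_injective.eq_iff, ext_demazure_eq ha hp hr]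
  refine and_congr_right fun he => ⟨fun h => ?_, fun h v hv => ?_⟩
  -- The effective letters of `a` form a reduced word `b` of a competitor `v` with the same Demazure
  -- product. Minimality of `w` makes `a` no longer than `b`, so the rank of the involution reached
  -- shows that `a` is itself ascending.
  · obtain ⟨b, hb, hbe, hA⟩ := exists_ascending 1 inv_one a
    have hb' : ∀ x ∈ b, x + 1 < n := fun x hx => ha x (hb x hx)
    obtain ⟨v, hv⟩ := exists_ext_eq_prodAdj hb'
    have hbr := hA.reduced hb'
    have h1 := h v (ext_injective (by rw [ext_demazure_eq hb' hv (by rw [← hv, hbr]), hbe, he]))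
    rw [len_eq, len_eq, ← hv, hbr, hr] at h1
    have h2 := (rank_foldl_act_one hb').2.2 hA
    have h3 := (rank_foldl_act_one ha).1
    rw [hbe] at h2
    exact (rank_foldl_act_one ha).2.1 (by omega)
  · obtain ⟨b, hb, hbp, hbr, hbe⟩ := ext_demazure v
    have h1 := (rank_foldl_act_one ha).2.2 h
    have h2 := (rank_foldl_act_one hb).1
    rw [← hbe, hv, ← he] at h2
    rw [len_eq, len_eq, hr, hbr]
    omega

/-! ### Lists of cells -/

open Classical in
/-- The antidiagonals of the cells of `D` in a list of cells, as a word. -/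
noncomputable def letters (D : Set (ℕ × ℕ)) (L : List (ℕ × ℕ)) : List ℕ :=
  (L.filter (· ∈ D)).map fun c => c.1 + c.2

@[simp] theorem letters_nil (D : Set (ℕ × ℕ)) : letters D [] = [] := rfl

@[simp] theorem letters_append (D : Set (ℕ × ℕ)) (L M : List (ℕ × ℕ)) :
    letters D (L ++ M) = letters D L ++ letters D M := by simp [letters]

theorem letters_cons_of_mem {D : Set (ℕ × ℕ)} {c : ℕ × ℕ} (h : c ∈ D) (L : List (ℕ × ℕ)) :
    letters D (c :: L) = (c.1 + c.2) :: letters D L := by simp [letters, h]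

theorem letters_cons_of_notMem {D : Set (ℕ × ℕ)} {c : ℕ × ℕ} (h : c ∉ D) (L : List (ℕ × ℕ)) :
    letters D (c :: L) = letters D L := by simp [letters, h]

theorem letters_congr {D E : Set (ℕ × ℕ)} {L : List (ℕ × ℕ)} (h : ∀ c ∈ L, c ∈ D ↔ c ∈ E) :
    letters D L = letters E L := by
  unfold letters
  rw [List.filter_congr]
  intro c hc
  simp [h c hc]

theorem mem_letters {D : Set (ℕ × ℕ)} {L : List (ℕ × ℕ)} {x : ℕ} :
    x ∈ letters D L ↔ ∃ c ∈ L, c ∈ D ∧ c.1 + c.2 = x := by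
  simp [letters, and_assoc]

theorem letters_bound {n : ℕ} {D : Set (ℕ × ℕ)} (hD : D ⊆ upperTriangle n) (L : List (ℕ × ℕ)) :
    ∀ x ∈ letters D L, x + 1 < n := by
  intro x hx
  obtain ⟨c, _, hc, rfl⟩ := mem_letters.1 hx
  have : c.1 + c.2 + 2 ≤ n := hD hc
  omega

/-- A reading order of the `n × n` matrix, starting in the northeast: a cell is read before the
cells weakly to the southwest of it. -/
structure IsReading (n : ℕ) (L : List (ℕ × ℕ)) : Prop where
  pairwise : L.Pairwise fun c c' => ¬(c'.1 ≤ c.1 ∧ c.2 ≤ c'.2)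
  mem_iff : ∀ c, c ∈ L ↔ c.1 < n ∧ c.2 < n

theorem IsReading.mem_suffix {n : ℕ} {A B : List (ℕ × ℕ)} (hL : IsReading n (A ++ B))
    {x y : ℕ × ℕ} (hx : x ∈ B) (hy : y.1 < n ∧ y.2 < n) (h1 : x.1 ≤ y.1) (h2 : y.2 ≤ x.2) :
    y ∈ B := by
  rcases List.mem_append.1 ((hL.mem_iff y).2 hy) with h | h
  · exact absurd ⟨h1, h2⟩ ((List.pairwise_append.1 hL.pairwise).2.2 y h x hx)
  · exact h

theorem IsReading.notMem {n : ℕ} {A B : List (ℕ × ℕ)} {c : ℕ × ℕ}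
    (hL : IsReading n (A ++ c :: B)) : c ∉ B := fun h =>
  (List.pairwise_cons.1 (List.pairwise_append.1 hL.pairwise).2.1).1 c h ⟨le_rfl, le_rfl⟩

/-! ### Following the pipes -/

variable {n p : ℕ} {D E : Set (ℕ × ℕ)}

theorem enters_west_zero {i : ℕ} : Enters D p (i, 0) Side.west ↔ p = i :=
  ⟨fun h => by cases h; rfl, fun h => h ▸ .start⟩

theorem enters_west_succ {i j : ℕ} : Enters D p (i, j + 1) Side.west ↔
    ((i, j) ∈ D ∧ Enters D p (i, j) Side.west) ∨ ((i, j) ∉ D ∧ Enters D p (i, j) Side.south) := by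
  constructor
  · intro h
    cases h with
    | cross_west h1 h2 => exact .inl ⟨h1, h2⟩
    | bend_south h1 h2 => exact .inr ⟨h1, h2⟩
  · rintro (⟨h1, h2⟩ | ⟨h1, h2⟩)
    exacts [.cross_west h1 h2, .bend_south h1 h2]

theorem enters_south {i j : ℕ} : Enters D p (i, j) Side.south ↔
    ((i + 1, j) ∈ D ∧ Enters D p (i + 1, j) Side.south) ∨
      ((i + 1, j) ∉ D ∧ Enters D p (i + 1, j) Side.west) := by
  constructor
  · intro h
    cases h with
    | cross_south h1 h2 => exact .inl ⟨h1, h2⟩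
    | bend_west h1 h2 => exact .inr ⟨h1, h2⟩
  · rintro (⟨h1, h2⟩ | ⟨h1, h2⟩)
    exacts [.cross_south h1 h2, .bend_west h1 h2]

/-- Below all cells of `D` every tile bends, so a pipe climbs along the antidiagonal on which it
starts. -/
theorem enters_west_of_le (hD : ∀ c ∈ D, c.1 < n) {i j : ℕ} (hi : n ≤ i) :
    Enters D p (i, j) Side.west ↔ p = i + j := by
  induction j generalizing i with
  | zero => exact enters_west_zero
  | succ j ih =>
    have h1 : (i, j) ∉ D := fun h => by have := hD _ h; simp only at this; omega
    have h2 : (i + 1, j) ∉ D := fun h => by have := hD _ h; simp only at this; omega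
    rw [enters_west_succ, enters_south, ih (i := i + 1) (by omega)]
    simp only [h1, h2, not_false_eq_true, true_and, false_and, false_or]
    omega

theorem adj_eq_right_iff {i m : ℕ} : adj i m = i + 1 ↔ m = i := by
  rw [adj_apply]; split_ifs <;> omega

theorem adj_eq_left_iff {i m : ℕ} : adj i m = i ↔ m = i + 1 := by
  rw [adj_apply]; split_ifs <;> omega

theorem adj_eq_iff_of_ne {i m k : ℕ} (h : k ≠ i) (h' : k ≠ i + 1) : adj i m = k ↔ m = k := by
  rw [adj_apply]; split_ifs <;> omega

/-- While the cells of a suffix `B` of a reading order are put in place, from the last one to the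
first one, the pipes crossing the boundary of `B` are permuted by the word of `B`. -/
theorem enters_iff (hD : D ⊆ upperTriangle n) {A B : List (ℕ × ℕ)} (hL : IsReading n (A ++ B)) :
    (∀ i j, i < n → j < n → (i, j) ∉ B → (j = 0 ∨ ∃ k, j = k + 1 ∧ (i, k) ∈ B) →
      (Enters D p (i, j) Side.west ↔ prodAdj (letters D B) p = i + j)) ∧
    (∀ i j, i < n → j < n → (i, j) ∉ B → (i + 1 = n ∨ (i + 1, j) ∈ B) →
      (Enters D p (i, j) Side.south ↔ prodAdj (letters D B) p = i + j + 1)) ∧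
    (∀ q, (0, q) ∈ B → (HasTopEndpoint D p q ↔ prodAdj (letters D B) p = q)) := by
  have hD' : ∀ c ∈ D, c.1 < n := fun c hc => by
    have : c.1 + c.2 + 2 ≤ n := hD hc
    omega
  induction B generalizing A with
  | nil =>
    refine ⟨fun i j _ _ _ h => ?_, fun i j _ _ _ h => ?_, fun q h => by simp at h⟩
    · obtain rfl : j = 0 := by simpa using h
      simp [enters_west_zero]
    · obtain rfl : i + 1 = n := by simpa using h
      have h1 : (i + 1, j) ∉ D := fun h => by have := hD' _ h; simp only at this; omega
      rw [enters_south, enters_west_of_le hD' le_rfl]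
      simp [h1]
      omega
  | cons c B ih =>
    obtain ⟨a, b⟩ := c
    have hL' : IsReading n ((A ++ [(a, b)]) ++ B) := by simpa using hL
    obtain ⟨ihW, ihS, ihT⟩ := ih hL'
    have hc : (a, b) ∉ B := hL.notMem
    have hab : a < n ∧ b < n := (hL.mem_iff (a, b)).1 (by simp)
    have hdown : ∀ {i j i' j'}, (i, j) ∈ B → i' < n → j' < n → i ≤ i' → j' ≤ j → (i', j') ∈ B :=
      fun h h1 h2 h3 h4 => hL'.mem_suffix h ⟨h1, h2⟩ h3 h4
    have hdc : ∀ {i' j'}, i' < n → j' < n → a ≤ i' → j' ≤ b → (i', j') ≠ (a, b) →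
        (i', j') ∈ B := fun h1 h2 h3 h4 h5 =>
      (List.mem_cons.1 (hL.mem_suffix (x := (a, b)) (y := (_, _)) (by simp) ⟨h1, h2⟩ h3 h4)
        ).resolve_left h5
    have hrW : b = 0 ∨ ∃ k, b = k + 1 ∧ (a, k) ∈ B := by
      cases b with
      | zero => exact .inl rfl
      | succ k => exact .inr ⟨k, rfl, hdc hab.1 (by omega) le_rfl (by omega) (by simp)⟩
    have hrS : a + 1 = n ∨ (a + 1, b) ∈ B := by
      by_cases h : a + 1 = n
      · exact .inl h
      · exact .inr (hdc (by omega) hab.2 (by omega) le_rfl (by simp))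
    have hW := ihW a b hab.1 hab.2 hc hrW
    have hS := ihS a b hab.1 hab.2 hc hrS
    have hkeep : ∀ k, k ≠ a + b → k ≠ a + b + 1 →
        (prodAdj (letters D ((a, b) :: B)) p = k ↔ prodAdj (letters D B) p = k) := by
      intro k h1 h2
      by_cases hm : (a, b) ∈ D
      · rw [letters_cons_of_mem hm, prodAdj_cons, Perm.mul_apply, adj_eq_iff_of_ne h1 h2]
      · rw [letters_cons_of_notMem hm]
    have hright : (((a, b) ∈ D ∧ Enters D p (a, b) Side.west) ∨
        ((a, b) ∉ D ∧ Enters D p (a, b) Side.south)) ↔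
        prodAdj (letters D ((a, b) :: B)) p = a + b + 1 := by
      by_cases hm : (a, b) ∈ D
      · rw [letters_cons_of_mem hm, prodAdj_cons, Perm.mul_apply, adj_eq_right_iff, ← hW]
        simp [hm]
      · rw [letters_cons_of_notMem hm, ← hS]
        simp [hm]
    have hleft : (((a, b) ∈ D ∧ Enters D p (a, b) Side.south) ∨
        ((a, b) ∉ D ∧ Enters D p (a, b) Side.west)) ↔
        prodAdj (letters D ((a, b) :: B)) p = a + b := by
      by_cases hm : (a, b) ∈ D
      · rw [letters_cons_of_mem hm, prodAdj_cons, Perm.mul_apply, adj_eq_left_iff, ← hS]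
        simp [hm]
      · rw [letters_cons_of_notMem hm, ← hW]
        simp [hm]
    refine ⟨fun i j hi hj hij hr => ?_, fun i j hi hj hij hr => ?_, fun q hq => ?_⟩
    · rw [List.mem_cons, not_or] at hij
      have hne : ¬(i = a ∧ j = b) := fun h => hij.1 (by rw [h.1, h.2])
      by_cases hcase : i = a ∧ j = b + 1
      · obtain ⟨rfl, rfl⟩ := hcase
        rw [enters_west_succ, hright, add_assoc]
      · have hr' : j = 0 ∨ ∃ k, j = k + 1 ∧ (i, k) ∈ B := by
          refine hr.imp_right fun ⟨k, hk, hm⟩ => ⟨k, hk, (List.mem_cons.1 hm).resolve_left ?_⟩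
          rintro h
          simp only [Prod.mk.injEq] at h
          omega
        -- No other boundary edge carries one of the two labels changed at `(a, b)`: either its cell
        -- would be weakly southwest of `(a, b)` and hence in `B`, or `(a, b)` would be weakly
        -- southwest of a cell of `B`.
        rw [ihW i j hi hj hij.2 hr', hkeep]
        all_goals
          intro h
          rcases Nat.lt_or_ge a i with hai | hai
          · exact hij.2 (hdc hi hj (by omega) (by omega) (by simp; omega))
          · obtain h0 | ⟨k, hk, hm⟩ := hr'
            · omega
            · exact hc (hdown hm hab.1 hab.2 (by omega) (by omega))
    · rw [List.mem_cons, not_or] at hij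
      have hne : ¬(i = a ∧ j = b) := fun h => hij.1 (by rw [h.1, h.2])
      by_cases hcase : i + 1 = a ∧ j = b
      · obtain ⟨rfl, rfl⟩ := hcase
        rw [enters_south, hleft]
        omega
      · have hr' : i + 1 = n ∨ (i + 1, j) ∈ B := by
          refine hr.imp_right fun hm => (List.mem_cons.1 hm).resolve_left ?_
          rintro h
          simp only [Prod.mk.injEq] at h
          omega
        rw [ihS i j hi hj hij.2 hr', hkeep]
        all_goals
          intro h
          rcases Nat.lt_or_ge i a with hai | hai
          · obtain h0 | hm := hr'
            · omega
            · exact hc (hdown hm hab.1 hab.2 (by omega) (by omega))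
          · exact hij.2 (hdc hi hj (by omega) (by omega) (by simp; omega))
    · by_cases hq' : (0, q) = (a, b)
      · simp only [Prod.mk.injEq] at hq'
        obtain ⟨rfl, rfl⟩ := hq'
        rw [HasTopEndpoint, hleft, zero_add]
      · have hm := (List.mem_cons.1 hq).resolve_left hq'
        rw [ihT q hm, hkeep]
        all_goals
          rintro rfl
          exact hc (hdown hm hab.1 hab.2 (by omega) (by omega))

theorem enters_cell_iff (hD : D ⊆ upperTriangle n) {A B : List (ℕ × ℕ)} {c : ℕ × ℕ}
    (hL : IsReading n (A ++ c :: B)) :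
    (Enters D p c Side.west ↔ prodAdj (letters D B) p = c.1 + c.2) ∧
      (Enters D p c Side.south ↔ prodAdj (letters D B) p = c.1 + c.2 + 1) := by
  obtain ⟨a, b⟩ := c
  have hL' : IsReading n ((A ++ [(a, b)]) ++ B) := by simpa using hL
  have hab : a < n ∧ b < n := (hL.mem_iff (a, b)).1 (by simp)
  have hdc : ∀ {i' j'}, i' < n → j' < n → a ≤ i' → j' ≤ b → (i', j') ≠ (a, b) →
      (i', j') ∈ B := fun h1 h2 h3 h4 h5 =>
    (List.mem_cons.1 (hL.mem_suffix (x := (a, b)) (y := (_, _)) (by simp) ⟨h1, h2⟩ h3 h4)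
      ).resolve_left h5
  obtain ⟨hW, hS, -⟩ := enters_iff (p := p) hD hL'
  constructor
  · refine hW a b hab.1 hab.2 hL.notMem ?_
    cases b with
    | zero => exact .inl rfl
    | succ k => exact .inr ⟨k, rfl, hdc hab.1 (by omega) le_rfl (by omega) (by simp)⟩
  · refine hS a b hab.1 hab.2 hL.notMem ?_
    by_cases h : a + 1 = n
    · exact .inl h
    · exact .inr (hdc (by omega) hab.2 (by omega) le_rfl (by simp))

theorem passesThrough_iff (hD : D ⊆ upperTriangle n) {A B : List (ℕ × ℕ)} {c : ℕ × ℕ}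
    (hL : IsReading n (A ++ c :: B)) :
    PassesThrough D p c ↔ prodAdj (letters D B) p = c.1 + c.2 ∨
      prodAdj (letters D B) p = c.1 + c.2 + 1 := by
  obtain ⟨hW, hS⟩ := enters_cell_iff (p := p) hD hL
  rw [← hW, ← hS]
  exact ⟨fun ⟨s, hs⟩ => by cases s; exacts [.inl hs, .inr hs],
    fun h => h.elim (fun h => ⟨_, h⟩) fun h => ⟨_, h⟩⟩

theorem crossAt_iff (hD : D ⊆ upperTriangle n) {A B : List (ℕ × ℕ)} {c : ℕ × ℕ}
    (hL : IsReading n (A ++ c :: B)) {q : ℕ} :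
    CrossAt D p q c ↔ c ∈ D ∧
      ((prodAdj (letters D B) p = c.1 + c.2 ∧ prodAdj (letters D B) q = c.1 + c.2 + 1) ∨
      (prodAdj (letters D B) q = c.1 + c.2 ∧ prodAdj (letters D B) p = c.1 + c.2 + 1)) := by
  rw [CrossAt, (enters_cell_iff hD hL).1, (enters_cell_iff hD hL).1, (enters_cell_iff hD hL).2,
    (enters_cell_iff hD hL).2]

/-- A simple transposition reverses the order of two values only if it exchanges exactly these two,
so an inversion can only arise where the two pipes cross. -/
theorem exists_crossAt (hD : D ⊆ upperTriangle n) {A B : List (ℕ × ℕ)}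
    (hL : IsReading n (A ++ B)) {q : ℕ} (hpq : p < q)
    (h : prodAdj (letters D B) q < prodAdj (letters D B) p) : ∃ c ∈ B, CrossAt D p q c := by
  induction B generalizing A with
  | nil => simp at h; omega
  | cons c B ih =>
    have hL' : IsReading n ((A ++ [c]) ++ B) := by simpa using hL
    by_cases hB : prodAdj (letters D B) q < prodAdj (letters D B) p
    · obtain ⟨c', hc', hx⟩ := ih hL' hB
      exact ⟨c', by simp [hc'], hx⟩
    · by_cases hm : c ∈ D
      · refine ⟨c, by simp, (crossAt_iff hD hL).2 ⟨hm, .inl ?_⟩⟩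
        rw [letters_cons_of_mem hm, prodAdj_cons, Perm.mul_apply, Perm.mul_apply] at h
        by_contra hc
        have hne : prodAdj (letters D B) p ≠ prodAdj (letters D B) q := fun h => by
          have := (prodAdj (letters D B)).injective h
          omega
        exact absurd h (adj_lt_adj (lt_of_le_of_ne (not_lt.1 hB) hne) hc).not_gt
      · rw [letters_cons_of_notMem hm] at h
        exact absurd h hB

/-- Two pipes cross at most once if every crossing increases the number of inversions. -/
theorem crossAt_unique (hD : D ⊆ upperTriangle n) {A B : List (ℕ × ℕ)}
    (hL : IsReading n (A ++ B))
    (hup : ∀ A' c B', B = A' ++ c :: B' → c ∈ D →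
      (prodAdj (letters D B'))⁻¹ (c.1 + c.2) < (prodAdj (letters D B'))⁻¹ (c.1 + c.2 + 1))
    {q : ℕ} (hpq : p < q) :
    (∀ c ∈ B, CrossAt D p q c → prodAdj (letters D B) q < prodAdj (letters D B) p) ∧
      ∀ c ∈ B, ∀ c' ∈ B, CrossAt D p q c → CrossAt D p q c' → c = c' := by
  induction B generalizing A with
  | nil => simp
  | cons x B ih =>
    have hL' : IsReading n ((A ++ [x]) ++ B) := by simpa using hL
    obtain ⟨ih1, ih2⟩ := ih hL' fun A' c B' h => hup (x :: A') c B' (by simp [h])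
    have hx : CrossAt D p q x → x ∈ D ∧ prodAdj (letters D B) p = x.1 + x.2 ∧
        prodAdj (letters D B) q = x.1 + x.2 + 1 := fun h => by
      rw [crossAt_iff hD hL] at h
      refine ⟨h.1, h.2.resolve_right fun h' => ?_⟩
      have := hup [] x B rfl h.1
      rw [← h'.2, ← h'.1] at this
      simp at this
      omega
    have hx' : CrossAt D p q x → ∀ c ∈ B, ¬CrossAt D p q c := fun h c hc hcc => by
      have := ih1 c hc hcc
      have := hx h
      omega
    constructor
    · intro c hc hcc
      rcases List.mem_cons.1 hc with rfl | hc
      · obtain ⟨h1, h2, h3⟩ := hx hcc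
        rw [letters_cons_of_mem h1, prodAdj_cons, Perm.mul_apply, Perm.mul_apply, h2, h3]
        simp
      · have h := ih1 c hc hcc
        by_cases hm : x ∈ D
        · rw [letters_cons_of_mem hm, prodAdj_cons, Perm.mul_apply, Perm.mul_apply]
          refine adj_lt_adj h fun h' => hx' ?_ c hc hcc
          rw [crossAt_iff hD hL]
          exact ⟨hm, .inr h'⟩
        · rwa [letters_cons_of_notMem hm]
    · intro c hc c' hc' hcc hcc'
      rcases List.mem_cons.1 hc with h | h <;> rcases List.mem_cons.1 hc' with h' | h'
      · rw [h, h']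
      · exact absurd hcc' (hx' (h ▸ hcc) _ h')
      · exact absurd hcc (hx' (h' ▸ hcc') _ h)
      · exact ih2 c h c' h' hcc hcc'

theorem CrossAt.symm {q : ℕ} {c : ℕ × ℕ} (h : CrossAt D p q c) : CrossAt D q p c :=
  ⟨h.1, h.2.symm⟩

theorem letters_length_eq (hD : D ⊆ upperTriangle n) {B : List (ℕ × ℕ)}
    (hup : ∀ A' c B', B = A' ++ c :: B' → c ∈ D →
      (prodAdj (letters D B'))⁻¹ (c.1 + c.2) < (prodAdj (letters D B'))⁻¹ (c.1 + c.2 + 1)) :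
    invNum n (prodAdj (letters D B)) = (letters D B).length := by
  induction B with
  | nil => simp [invNum_one]
  | cons x B ih =>
    have ih := ih fun A' c B' h => hup (x :: A') c B' (by simp [h])
    by_cases hm : x ∈ D
    · have hx : x.1 + x.2 + 2 ≤ n := hD hm
      rw [letters_cons_of_mem hm, prodAdj_cons, invNum_adj_mul
        (FixesFrom.prodAdj (letters_bound hD B)) (by omega) (hup [] x B rfl hm), ih,
        List.length_cons]
    · rw [letters_cons_of_notMem hm, ih]

/-- A set of cells is a reduced pipe dream for `w` if its word in a reading order is a reduced
word for `w`. -/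
theorem mem_PD_iff {L : List (ℕ × ℕ)} (hL : IsReading n L) {w : Perm (Fin n)} :
    D ∈ PD w ↔ D ⊆ upperTriangle n ∧ prodAdj (letters D L) = ext w ∧
      invNum n (ext w) = (letters D L).length := by
  rw [PD, Set.mem_ofPred_eq, IsReducedPipeDream, and_assoc]
  refine and_congr_right fun hD => ?_
  have hfix := FixesFrom.prodAdj (letters_bound hD L)
  have htop : (∀ q : Fin n, HasTopEndpoint D q (w q)) ↔ prodAdj (letters D L) = ext w := by
    have key : ∀ q : Fin n, HasTopEndpoint D q (w q) ↔ prodAdj (letters D L) q = w q := fun q =>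
      (enters_iff (A := []) (B := L) hD hL).2.2 (w q) ((hL.mem_iff _).2 ⟨by
        have := q.2
        simp only
        omega, (w q).2⟩)
    constructor
    · intro h
      ext m
      by_cases hm : m < n
      · rw [ext_mk w hm]
        exact (key ⟨m, hm⟩).1 (h ⟨m, hm⟩)
      · rw [fixesFrom_ext w m (by omega), hfix m (by omega)]
    · intro h q
      rw [key, h, ext_val]
  rw [htop, and_comm]
  refine and_congr_right fun hw => ?_
  rw [← hw]
  constructor
  · intro hred
    refine letters_length_eq hD fun A c B hAB hc => ?_
    subst hAB
    set u := prodAdj (letters D B) with hu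
    have hcn : c.1 + c.2 + 2 ≤ n := hD hc
    have hfu : FixesFrom n u := FixesFrom.prodAdj (letters_bound hD B)
    -- If the crossing at `c` removed an inversion, its two pipes would already have crossed in a
    -- cell of `B`.
    by_contra hlt
    have hlt' := lt_of_le_of_ne (not_lt.1 hlt) (perm_ne_succ u⁻¹ _).symm
    have h1 : u (u⁻¹ (c.1 + c.2)) = c.1 + c.2 := by simp
    have h2 : u (u⁻¹ (c.1 + c.2 + 1)) = c.1 + c.2 + 1 := by simp
    have hL' : IsReading n ((A ++ [c]) ++ B) := by simpa using hL
    obtain ⟨c', hc', hx⟩ := exists_crossAt hD hL' hlt' (by rw [← hu, h1, h2]; omega)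
    have := hred ⟨_, hfu.inv.lt (m := c.1 + c.2 + 1) (by omega)⟩
      ⟨_, hfu.inv.lt (m := c.1 + c.2) (by omega)⟩ (by simp) c' c hx
      ((crossAt_iff hD hL).2 ⟨hc, .inr ⟨h1, h2⟩⟩)
    exact hL.notMem (this ▸ hc')
  · intro hr
    have hup : ∀ A c B, L = A ++ c :: B → c ∈ D →
        (prodAdj (letters D B))⁻¹ (c.1 + c.2) < (prodAdj (letters D B))⁻¹ (c.1 + c.2 + 1) := by
      rintro A c B rfl hc
      have hcn : c.1 + c.2 + 2 ≤ n := hD hc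
      have hlet : letters D (A ++ c :: B) = letters D A ++ ((c.1 + c.2) :: letters D B) ++ [] := by
        simp [letters_cons_of_mem hc]
      have hb := letters_bound hD (A ++ c :: B)
      rw [hlet] at hr hb
      have h1 := invNum_prodAdj_infix hb hr
      have h2 := invNum_prodAdj_le (letters_bound hD B)
      rw [prodAdj_cons, List.length_cons] at h1
      exact lt_of_invNum_adj_mul (FixesFrom.prodAdj (letters_bound hD B)) (by omega) (by omega)
    have hmem : ∀ c ∈ D, c ∈ L := fun c hc => by
      have : c.1 + c.2 + 2 ≤ n := hD hc
      exact (hL.mem_iff c).2 (by omega)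
    intro q q' hne c c' hc hc'
    rcases lt_or_gt_of_ne hne with h | h
    · exact (crossAt_unique (A := []) hD hL hup h).2 c (hmem c hc.1) c' (hmem c' hc'.1) hc hc'
    · exact (crossAt_unique (A := []) hD hL hup h).2 c (hmem c hc.1) c' (hmem c' hc'.1)
        hc.symm hc'.symm

/-! ### Reading rows from right to left, top to bottom -/

/-- The first `m` cells of row `i`, from right to left. -/
def rowCells (i : ℕ) : ℕ → List (ℕ × ℕ)
  | 0 => []
  | m + 1 => (i, m) :: rowCells i m

/-- The first `n` cells of `m` consecutive rows starting with row `i`. -/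
def rowsCells (n i : ℕ) : ℕ → List (ℕ × ℕ)
  | 0 => []
  | m + 1 => rowsCells n i m ++ rowCells (i + m) n

theorem mem_rowCells {i m : ℕ} {c : ℕ × ℕ} : c ∈ rowCells i m ↔ c.1 = i ∧ c.2 < m := by
  induction m with
  | zero => simp [rowCells]
  | succ m ih => rw [rowCells, List.mem_cons, ih, Prod.ext_iff]; simp only; omega

theorem mem_rowsCells {n i m : ℕ} {c : ℕ × ℕ} :
    c ∈ rowsCells n i m ↔ (i ≤ c.1 ∧ c.1 < i + m) ∧ c.2 < n := by
  induction m with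
  | zero => simp [rowsCells]
  | succ m ih => rw [rowsCells, List.mem_append, ih, mem_rowCells]; omega

theorem rowsCells_add (n i m m' : ℕ) :
    rowsCells n i (m + m') = rowsCells n i m ++ rowsCells n (i + m) m' := by
  induction m' with
  | zero => simp [rowsCells]
  | succ m' ih => rw [← add_assoc, rowsCells, ih, rowsCells, List.append_assoc, add_assoc]

theorem rowsCells_one (n i : ℕ) : rowsCells n i 1 = rowCells i n := by simp [rowsCells]

theorem rowCells_pairwise (i m : ℕ) :
    (rowCells i m).Pairwise fun c c' => c.1 < c'.1 ∨ (c.1 = c'.1 ∧ c'.2 < c.2) := by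
  induction m with
  | zero => simp [rowCells]
  | succ m ih =>
    rw [rowCells, List.pairwise_cons]
    refine ⟨fun c hc => .inr ?_, ih⟩
    rw [mem_rowCells] at hc
    exact ⟨hc.1.symm, hc.2⟩

theorem rowsCells_pairwise (n i m : ℕ) :
    (rowsCells n i m).Pairwise fun c c' => c.1 < c'.1 ∨ (c.1 = c'.1 ∧ c'.2 < c.2) := by
  induction m with
  | zero => simp [rowsCells]
  | succ m ih =>
    rw [rowsCells, List.pairwise_append]
    refine ⟨ih, rowCells_pairwise _ _, fun c hc c' hc' => .inl ?_⟩
    rw [mem_rowsCells] at hc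
    rw [mem_rowCells] at hc'
    omega

/-- The word of a set of cells of the `n × n` matrix. -/
noncomputable def word (n : ℕ) (D : Set (ℕ × ℕ)) : List ℕ := letters D (rowsCells n 0 n)

theorem isReading_rowsCells (n : ℕ) : IsReading n (rowsCells n 0 n) where
  pairwise := (rowsCells_pairwise n 0 n).imp fun h => by omega
  mem_iff c := by rw [mem_rowsCells]; omega

/-- The reduced pipe dreams of atoms of `z` are the sets of cells whose word is an ascending word
leading to `z`. -/
theorem mem_IDPlus_iff {z : Perm (Fin n)} : D ∈ IDPlus z ↔ D ⊆ upperTriangle n ∧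
    (word n D).foldl act 1 = ext z ∧ Ascending 1 (word n D) := by
  simp only [IDPlus, Set.mem_iUnion, exists_prop, mem_PD_iff (isReading_rowsCells n)]
  constructor
  · rintro ⟨w, hw, hD, hp, hr⟩
    exact ⟨hD, (mem_atoms_iff (letters_bound hD _) hp hr).1 hw⟩
  · rintro ⟨hD, he, hA⟩
    have hb := letters_bound hD (rowsCells n 0 n)
    obtain ⟨w, hw⟩ := exists_ext_eq_prodAdj hb
    have hr : invNum n (ext w) = (letters D (rowsCells n 0 n)).length := by
      rw [← hw, Ascending.reduced hb hA]
    exact ⟨w, (mem_atoms_iff hb hw hr).2 ⟨he, hA⟩, hD, hw, hr⟩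

theorem word_bound (hD : D ⊆ upperTriangle n) : ∀ x ∈ word n D, x + 1 < n := letters_bound hD _

/-! ### The effect of ladder moves on words -/

theorem rowCells_split {k N : ℕ} (i : ℕ) (h : k ≤ N) :
    ∃ R, rowCells i N = R ++ rowCells i k ∧ ∀ c ∈ R, c.1 = i ∧ k ≤ c.2 := by
  induction N, h using Nat.le_induction with
  | base => exact ⟨[], by simp⟩
  | succ N hN ih =>
    obtain ⟨R, hR, hc⟩ := ih
    refine ⟨(i, N) :: R, by rw [rowCells, hR]; rfl, ?_⟩
    simp only [List.mem_cons]
    rintro c (rfl | h)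
    exacts [⟨rfl, hN⟩, hc c h]

/-- A letter is moved past a row containing the cells in columns `k` and `k + 1`. -/
theorem WEq.row {r k N : ℕ} (hk : k + 2 ≤ N) (h : (r, k) ∈ D) (h' : (r, k + 1) ∈ D) :
    WEq ((r + k) :: letters D (rowCells r N)) (letters D (rowCells r N) ++ [r + k + 1]) := by
  obtain ⟨R, hR, hRc⟩ := rowCells_split r hk
  have h1 : WEq ((r + k) :: letters D R) (letters D R ++ [r + k]) := by
    refine .cons_comm fun x hx => ?_
    obtain ⟨c, hc, _, rfl⟩ := mem_letters.1 hx
    have := hRc c hc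
    omega
  have h2 : WEq ((r + k + 1) :: letters D (rowCells r k))
      (letters D (rowCells r k) ++ [r + k + 1]) := by
    refine .cons_comm fun x hx => ?_
    obtain ⟨c, hc, _, rfl⟩ := mem_letters.1 hx
    have := mem_rowCells.1 hc
    omega
  rw [hR, rowCells, rowCells, letters_append, letters_cons_of_mem h', letters_cons_of_mem h]
  intro y
  have h1 := h1 y
  have h2 := fun y => h2 y
  simp only [List.foldl_cons, List.foldl_append, List.foldl_nil] at h1 h2 ⊢
  -- Between the cells to the right and those to the left, the letters `r + k, r + k + 1, r + k`
  -- become `r + k + 1, r + k, r + k + 1`.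
  rw [h1, ← h2, ← add_assoc, act_braid]

/-- Each full row raises the passing letter by one, just as the antidiagonal rises by one per row
within a fixed column. The letter of `(i, k + 1)` thus arrives as that of `(i + 1 + m, k)`. -/
theorem WEq.rows {i k N m : ℕ} (hk : k + 2 ≤ N)
    (h : ∀ r, i < r → r < i + 1 + m → (r, k) ∈ D ∧ (r, k + 1) ∈ D) :
    WEq ((i + k + 1) :: letters D (rowCells i k ++ rowsCells N (i + 1) m))
      (letters D (rowCells i k ++ rowsCells N (i + 1) m) ++ [i + m + k + 1]) := by
  induction m with
  | zero =>
    refine .cons_comm fun x hx => ?_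
    obtain ⟨c, hc, _, rfl⟩ := mem_letters.1 hx
    rw [rowsCells, List.append_nil] at hc
    have := mem_rowCells.1 hc
    omega
  | succ m ih =>
    obtain ⟨h1, h2⟩ := h (i + 1 + m) (by omega) (by omega)
    have h3 := WEq.row hk h1 h2
    have ih := ih fun r hr hr' => h r hr (by omega)
    rw [rowsCells, ← List.append_assoc, letters_append, ← List.cons_append]
    refine (ih.append (.refl _)).trans ?_
    rw [List.append_assoc, List.append_assoc]
    refine (WEq.refl _).append ?_
    rw [show i + m + k + 1 = i + 1 + m + k by ring,
      show i + (m + 1) + k + 1 = i + 1 + m + k + 1 by ring]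
    exact h3

theorem rdem_fixed {v : Perm ℕ} {x m : ℕ} (h : v m = m) (h1 : m ≠ x) (h2 : m ≠ x + 1) :
    rdem v x m = m := by
  unfold rdem
  split_ifs
  · rw [Perm.mul_apply, adj_of_ne h1 h2, h]
  · exact h

theorem act_fixed {v : Perm ℕ} {x m : ℕ} (h : v m = m) (h1 : m ≠ x) (h2 : m ≠ x + 1) :
    act v x m = m := by
  have h3 := rdem_fixed h h1 h2
  rw [act, ldem, Perm.inv_eq_iff_eq, rdem_fixed _ h1 h2]
  rw [Perm.inv_eq_iff_eq, h3]

theorem foldl_act_fixed {v : Perm ℕ} {m : ℕ} {a : List ℕ} (h : v m = m)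
    (ha : ∀ x ∈ a, m ≠ x ∧ m ≠ x + 1) : a.foldl act v m = m := by
  induction a generalizing v with
  | nil => exact h
  | cons x a ih =>
    have hx := ha x (by simp)
    exact ih (act_fixed h hx.1 hx.2) fun z hz => ha z (by simp [hz])

/-- The letters of two adjacent simple transpositions may be exchanged if they are applied to an
involution fixing the three points. -/
theorem act_act_comm_of_fixed {y : Perm ℕ} (hy : y⁻¹ = y) {x : ℕ} (h0 : y x = x)
    (h1 : y (x + 1) = x + 1) (h2 : y (x + 2) = x + 2) :
    act (act y x) (x + 1) = act (act y (x + 1)) x := by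
  have e1 : act y x = y * adj x := act_of_fixed hy h0 h1
  have e2 : act y (x + 1) = y * adj (x + 1) := act_of_fixed hy h1 h2
  have hx2 : adj x (x + 2) = x + 2 := adj_of_ne (by omega) (by omega)
  have hx0 : adj (x + 1) x = x := adj_of_ne (by omega) (by omega)
  have hs : ∀ i, y i = i → y (i + 1) = i + 1 → adj i * y = y * adj i := fun i hi hi' => by
    rw [conj_adj, hi, hi', adj]
  -- The first letter multiplies, the second conjugates, and both orders give `y` times the
  -- transposition of `x` and `x + 2`, written in its two braid forms.
  rw [act_of_lt (act_inv hy x), act_of_lt (act_inv hy (x + 1)), e1, e2, ← mul_assoc,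
    ← mul_assoc, hs x h0 h1, hs (x + 1) h1 h2, mul_assoc y, mul_assoc y, mul_assoc y, mul_assoc y,
    adj_braid]
  · rw [e2, Perm.mul_apply, Perm.mul_apply, hx0, h0, adj_left, h2]; omega
  · rw [e2, Perm.mul_apply, Perm.mul_apply, hx0, h0, adj_left, h2]; omega
  · rw [e1, Perm.mul_apply, Perm.mul_apply, adj_right, h0, hx2, h2]; omega
  · rw [e1, Perm.mul_apply, Perm.mul_apply, adj_right, h0, hx2, h2]; omega

/-- Conditions on `(i, k + 1) ∈ E` under which this cell may be moved down: either `(i, k)` is not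
in `E`, or the conditions of an involution ladder move are satisfied. -/
def CanDrop (E : Set (ℕ × ℕ)) (i k : ℕ) : Prop :=
  (i, k) ∉ E ∨ ((i, k) ∈ E ∧ (i, k + 2) ∉ E ∧
    ∀ a b : ℕ, a < i → i + k ≤ a + b + 1 → a + b ≤ i + k + 2 → (a, b) ∉ E)

/-- The target `(j, k)` is on the antidiagonal of `(j - 1, k + 1)`, which is a cell of a full row or
the dropped cell itself. -/
theorem drop_lt {i j k : ℕ} (hE : E ⊆ upperTriangle n) (hij : i < j)
    (hfull : ∀ r, i < r → r < j → (r, k) ∈ E ∧ (r, k + 1) ∈ E) (h1 : (i, k + 1) ∈ E) :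
    j + k + 2 ≤ n := by
  rcases Nat.lt_or_ge (i + 1) j with h | h
  · have : j - 1 + (k + 1) + 2 ≤ n := hE (hfull (j - 1) (by omega) (by omega)).2
    omega
  · have : i + (k + 1) + 2 ≤ n := hE h1
    omega

/-- Replacing `(i, k + 1)` by `(j, k)` does not change the effect of the word. -/
theorem foldl_act_drop {i j k : ℕ} (hE : E ⊆ upperTriangle n) (hij : i < j)
    (hfull : ∀ r, i < r → r < j → (r, k) ∈ E ∧ (r, k + 1) ∈ E) (h1 : (i, k + 1) ∈ E)
    (h2 : (j, k + 1) ∉ E) (hc : CanDrop E i k) :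
    (word n E).foldl act 1 = (word n (insert (j, k) (E \ {(i, k + 1)}))).foldl act 1 ∧
      ((j, k) ∉ E → (word n E).length = (word n (insert (j, k) (E \ {(i, k + 1)}))).length) ∧
      ((j, k) ∈ E →
        (word n E).length = (word n (insert (j, k) (E \ {(i, k + 1)}))).length + 1) := by
  have hjn := drop_lt hE hij hfull h1
  set D := insert (j, k) (E \ {(i, k + 1)}) with hD
  have hmem : ∀ c, c ≠ (j, k) → c ≠ (i, k + 1) → (c ∈ E ↔ c ∈ D) := fun c hc1 hc2 => by
    simp [hD, hc1, hc2]
  obtain ⟨m, rfl⟩ : ∃ m, j = i + 1 + m := ⟨j - (i + 1), by omega⟩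
  obtain ⟨m', hm'⟩ : ∃ m', n = i + 1 + m + 1 + m' := ⟨n - (i + 1 + m + 1), by omega⟩
  have hk : k + 2 ≤ n := by omega
  obtain ⟨R, hR, hRc⟩ := rowCells_split i hk
  obtain ⟨R', hR', hRc'⟩ := rowCells_split (i + 1 + m) hk
  have hcells : rowsCells n 0 n = (rowsCells n 0 i ++ R) ++ [(i, k + 1)] ++ [(i, k)] ++
      (rowCells i k ++ rowsCells n (i + 1) m) ++ R' ++ [(i + 1 + m, k + 1)] ++ [(i + 1 + m, k)] ++
      (rowCells (i + 1 + m) k ++ rowsCells n (i + 1 + m + 1) m') := by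
    conv_lhs => rw [show rowsCells n 0 n = rowsCells n 0 (i + 1 + m + 1 + m') by rw [← hm']]
    rw [rowsCells_add, rowsCells_add, rowsCells_add, rowsCells_add, zero_add, zero_add, zero_add,
      zero_add, rowsCells_one, rowsCells_one, hR, hR']
    simp [rowCells]
  have hw : ∀ F : Set (ℕ × ℕ), word n F = letters F (rowsCells n 0 i ++ R) ++
      letters F [(i, k + 1)] ++ letters F [(i, k)] ++
      letters F (rowCells i k ++ rowsCells n (i + 1) m) ++ letters F R' ++
      letters F [(i + 1 + m, k + 1)] ++ letters F [(i + 1 + m, k)] ++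
      letters F (rowCells (i + 1 + m) k ++ rowsCells n (i + 1 + m + 1) m') := fun F => by
    rw [word, hcells]
    simp only [letters_append]
  have hwD : word n D = letters E (rowsCells n 0 i ++ R) ++ letters E [(i, k)] ++
      letters E (rowCells i k ++ rowsCells n (i + 1) m) ++ letters E R' ++ [i + 1 + m + k] ++
      letters E (rowCells (i + 1 + m) k ++ rowsCells n (i + 1 + m + 1) m') := by
    have e1 : letters D [(i, k + 1)] = [] := by
      rw [letters_cons_of_notMem, letters_nil]
      simp [hD]
    have e2 : letters D [(i + 1 + m, k + 1)] = [] := by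
      rw [letters_cons_of_notMem, letters_nil]
      rw [← hmem _ (by simp) (by simp; omega)]
      exact h2
    have e3 : letters D [(i + 1 + m, k)] = [i + 1 + m + k] := by
      rw [letters_cons_of_mem (by simp [hD]), letters_nil]
    rw [hw, e1, e2, e3]
    have hcong : ∀ L : List (ℕ × ℕ), (∀ c ∈ L, c ≠ (i + 1 + m, k) ∧ c ≠ (i, k + 1)) →
        letters D L = letters E L := fun L hL =>
      letters_congr fun c hc => (hmem c (hL c hc).1 (hL c hc).2).symm
    rw [hcong (rowsCells n 0 i ++ R), hcong [(i, k)],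
      hcong (rowCells i k ++ rowsCells n (i + 1) m), hcong R',
      hcong (rowCells (i + 1 + m) k ++ rowsCells n (i + 1 + m + 1) m')]
    · simp
    · rintro ⟨a, b⟩ hc
      simp only [List.mem_append, mem_rowCells, mem_rowsCells, ne_eq, Prod.mk.injEq] at hc ⊢
      omega
    · rintro ⟨a, b⟩ hc
      have := hRc' _ hc
      simp only [ne_eq, Prod.mk.injEq] at this ⊢
      omega
    · rintro ⟨a, b⟩ hc
      simp only [List.mem_append, mem_rowCells, mem_rowsCells, ne_eq, Prod.mk.injEq] at hc ⊢
      omega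
    · rintro ⟨a, b⟩ hc
      simp only [List.mem_singleton, ne_eq, Prod.mk.injEq] at hc ⊢
      omega
    · rintro ⟨a, b⟩ hc
      rcases List.mem_append.1 hc with hc | hc
      · simp only [mem_rowsCells, ne_eq, Prod.mk.injEq] at hc ⊢
        omega
      · have := hRc _ hc
        simp only [ne_eq, Prod.mk.injEq] at this ⊢
        omega
  have hwE : word n E = letters E (rowsCells n 0 i ++ R) ++ [i + k + 1] ++ letters E [(i, k)] ++
      letters E (rowCells i k ++ rowsCells n (i + 1) m) ++ letters E R' ++
      letters E [(i + 1 + m, k)] ++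
      letters E (rowCells (i + 1 + m) k ++ rowsCells n (i + 1 + m + 1) m') := by
    rw [hw, letters_cons_of_mem h1, letters_cons_of_notMem h2, letters_nil]
    simp [add_assoc]
  refine ⟨?_, fun hj => ?_, fun hj => ?_⟩
  · rw [hwE, hwD]
    have hS : WEq ([i + k + 1] ++ letters E (rowCells i k ++ rowsCells n (i + 1) m) ++
        letters E R' ++ letters E [(i + 1 + m, k)])
        (letters E (rowCells i k ++ rowsCells n (i + 1) m) ++ letters E R' ++
          [i + 1 + m + k]) := by
      have s1 := WEq.rows (D := E) (m := m) hk hfull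
      have s2 : WEq ([i + 1 + m + k] ++ letters E R') (letters E R' ++ [i + 1 + m + k]) := by
        refine .cons_comm fun x hx => ?_
        obtain ⟨c, hc, _, rfl⟩ := mem_letters.1 hx
        have := hRc' c hc
        omega
      -- If the target cell is occupied, the arriving letter is absorbed, and the new word is one
      -- letter shorter.
      have s3 : WEq ([i + 1 + m + k] ++ letters E [(i + 1 + m, k)]) [i + 1 + m + k] := by
        by_cases hj : (i + 1 + m, k) ∈ E
        · rw [letters_cons_of_mem hj, letters_nil]
          exact fun y => act_idem y _
        · rw [letters_cons_of_notMem hj, letters_nil]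
          exact .refl _
      rw [show i + m + k + 1 = i + 1 + m + k by ring] at s1
      refine ((s1.append (.refl _)).append (.refl _)).trans ?_
      simp only [List.append_assoc]
      refine (WEq.refl _).append ?_
      refine WEq.trans ?_ ((WEq.refl (letters E R')).append s3)
      rw [← List.append_assoc, ← List.append_assoc]
      exact s2.append (.refl _)
    rcases hc with hc | ⟨hc1, hc2, hc3⟩
    · rw [letters_cons_of_notMem hc, letters_nil]
      have := fun y => hS y
      simp only [List.foldl_append, List.append_nil] at this ⊢
      rw [this]
    · rw [letters_cons_of_mem hc1, letters_nil]
      -- A letter moves one of these three points only if it is one of `i + k - 1, …, i + k + 2`.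
      -- The last clause of `CanDrop` excludes these in the rows above, and `(i, k + 2) ∉ E` leaves
      -- only larger letters in `R`.
      have hfix : ∀ x, x = i + k ∨ x = i + k + 1 ∨ x = i + k + 2 →
          (letters E (rowsCells n 0 i ++ R)).foldl act 1 x = x := by
        intro x hx
        refine foldl_act_fixed rfl fun l hl => ?_
        obtain ⟨⟨a, b⟩, hc, hcE, rfl⟩ := mem_letters.1 hl
        simp only at *
        have hb : a + b + 1 < i + k ∨ i + k + 2 < a + b := by
          rcases List.mem_append.1 hc with hc | hc
          · have := mem_rowsCells.1 hc
            by_contra hn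
            exact hc3 a b (by omega) (by omega) (by omega) hcE
          · obtain ⟨rfl, hb⟩ := hRc _ hc
            simp only at hb hcE
            have : b ≠ k + 2 := by rintro rfl; exact hc2 hcE
            right; simp only; omega
        omega
      have hcomm := act_act_comm_of_fixed
        (foldl_act_inv inv_one (letters E (rowsCells n 0 i ++ R)))
        (hfix (i + k) (by simp)) (hfix (i + k + 1) (by simp)) (hfix (i + k + 2) (by simp))
      have := fun y => hS y
      simp only [List.foldl_append, List.foldl_cons, List.foldl_nil] at this hcomm ⊢
      rw [← hcomm, this]
  · rw [hwE, hwD, letters_cons_of_notMem hj]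
    simp
    omega
  · rw [hwE, hwD, letters_cons_of_mem hj]
    simp
    omega

/-! ### Invariance of `IDPlus` under moves, and a weight they decrease -/

theorem ascending_word_iff (hD : D ⊆ upperTriangle n) :
    Ascending 1 (word n D) ↔ rank n ((word n D).foldl act 1) = 4 * (word n D).length :=
  (rank_foldl_act_one (word_bound hD)).2.symm

theorem mem_IDPlus_congr {z : Perm (Fin n)} (hD : D ⊆ upperTriangle n) (hE : E ⊆ upperTriangle n)
    (h : (word n D).foldl act 1 = (word n E).foldl act 1)
    (hl : (word n D).length = (word n E).length) : D ∈ IDPlus z ↔ E ∈ IDPlus z := by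
  rw [mem_IDPlus_iff, mem_IDPlus_iff, ascending_word_iff hD, ascending_word_iff hE, h, hl]
  simp [hD, hE]

theorem insert_subset_upperTriangle {i j k : ℕ} (hE : E ⊆ upperTriangle n) (hij : i < j)
    (hfull : ∀ r, i < r → r < j → (r, k) ∈ E ∧ (r, k + 1) ∈ E) (h1 : (i, k + 1) ∈ E) :
    insert (j, k) (E \ {(i, k + 1)}) ⊆ upperTriangle n := by
  rintro c (rfl | hc)
  · exact drop_lt hE hij hfull h1
  · exact hE hc.1

/-- A cell of an element of `ℐ𝒟⁺(z)` that may be moved down is not moved onto another cell. -/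
theorem notMem_of_canDrop {z : Perm (Fin n)} {i j k : ℕ} (hE : E ∈ IDPlus z) (hij : i < j)
    (hfull : ∀ r, i < r → r < j → (r, k) ∈ E ∧ (r, k + 1) ∈ E) (h1 : (i, k + 1) ∈ E)
    (h2 : (j, k + 1) ∉ E) (hc : CanDrop E i k) : (j, k) ∉ E := by
  intro hj
  have hE' := (mem_IDPlus_iff.1 hE).1
  -- A word with one letter fewer and the same effect would violate the rank bound.
  obtain ⟨e1, -, e2⟩ := foldl_act_drop hE' hij hfull h1 h2 hc
  have hA := (ascending_word_iff hE').1 (mem_IDPlus_iff.1 hE).2.2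
  have := (rank_foldl_act_one
    (word_bound (insert_subset_upperTriangle hE' hij hfull h1))).1
  rw [← e1, hA, e2 hj] at this
  omega

/-- Seen from the target, both kinds of move are one operation, the drop of `(i, k + 1)` to `(j,
k)`. This is the form in which predecessors are constructed. -/
theorem move_iff : Move D E ↔ ∃ i j k : ℕ, i < j ∧
    (∀ r, i < r → r < j → (r, k) ∈ E ∧ (r, k + 1) ∈ E) ∧ (i, k + 1) ∈ E ∧ (j, k + 1) ∉ E ∧
    (j, k) ∉ E ∧ CanDrop E i k ∧ D = insert (j, k) (E \ {(i, k + 1)}) := by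
  have hDE : ∀ {i j k : ℕ}, i < j → (j, k) ∈ D → (i, k + 1) ∉ D →
      E = (D \ {(j, k)}) ∪ {(i, k + 1)} → D = insert (j, k) (E \ {(i, k + 1)}) ∧
      (∀ a b, ¬(a = i ∧ b = k + 1) → ¬(a = j ∧ b = k) → ((a, b) ∈ D ↔ (a, b) ∈ E)) ∧
      (i, k + 1) ∈ E ∧ (j, k) ∉ E := by
    rintro i j k hij h1 h2 rfl
    refine ⟨?_, fun a b h3 h4 => ?_, by simp, ?_⟩
    · ext c
      by_cases hc1 : c = (j, k)
      · simp [hc1, h1]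
      · by_cases hc2 : c = (i, k + 1)
        · subst hc2; simp [hc1, h2]
        · simp [hc1, hc2]
    · simp [h3, h4]
    · simp
  constructor
  · rintro (⟨i, j, k, hij, hfull, h1, h2, h3, h4, hE⟩ |
      ⟨i, j, k, hij, hfull, h1, h2, h3, h4, h5, hE, h6⟩)
    · obtain ⟨e1, e2, e3, e4⟩ := hDE hij h1 h3 hE
      refine ⟨i, j, k, hij, fun r hr hr' => ?_, e3, ?_, e4, .inl ?_, e1⟩
      · rw [← e2 _ _ (by omega) (by omega), ← e2 _ _ (by omega) (by omega)]
        exact hfull r hr hr'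
      · rwa [← e2 _ _ (by omega) (by omega)]
      · rwa [← e2 _ _ (by omega) (by omega)]
    · obtain ⟨e1, e2, e3, e4⟩ := hDE hij h2 h3 hE
      refine ⟨i, j, k, hij, fun r hr hr' => ?_, e3, ?_, e4, .inr ⟨?_, ?_, fun a b ha hb hb' => ?_⟩,
        e1⟩
      · rw [← e2 _ _ (by omega) (by omega), ← e2 _ _ (by omega) (by omega)]
        exact hfull r hr hr'
      · rwa [← e2 _ _ (by omega) (by omega)]
      · rwa [← e2 _ _ (by omega) (by omega)]
      · rwa [← e2 _ _ (by omega) (by omega)]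
      · rw [← e2 _ _ (by omega) (by omega)]
        exact h6 a b ha hb hb'
  · rintro ⟨i, j, k, hij, hfull, h1, h2, h3, hc, rfl⟩
    have e2 : ∀ a b, ¬(a = i ∧ b = k + 1) → ¬(a = j ∧ b = k) →
        ((a, b) ∈ insert (j, k) (E \ {(i, k + 1)}) ↔ (a, b) ∈ E) := fun a b h3 h4 => by
      simp [h3, h4]
    have e3 : E = insert (j, k) (E \ {(i, k + 1)}) \ {(j, k)} ∪ {(i, k + 1)} := by
      ext c
      by_cases hc1 : c = (j, k)
      · subst hc1; simp [h3]
      · by_cases hc2 : c = (i, k + 1)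
        · simp [hc2, h1]
        · simp [hc1, hc2]
    have e4 : (i, k + 1) ∉ insert (j, k) (E \ {(i, k + 1)}) := by simp
    have hfull' : ∀ r, i < r → r < j → (r, k) ∈ insert (j, k) (E \ {(i, k + 1)}) ∧
        (r, k + 1) ∈ insert (j, k) (E \ {(i, k + 1)}) := fun r hr hr' => by
      rw [e2 _ _ (by omega) (by omega), e2 _ _ (by omega) (by omega)]
      exact hfull r hr hr'
    have e5 : (j, k + 1) ∉ insert (j, k) (E \ {(i, k + 1)}) := by
      rwa [e2 _ _ (by omega) (by omega)]
    rcases hc with hc | ⟨hc1, hc2, hc3⟩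
    · exact .inl ⟨i, j, k, hij, hfull', by simp, by rwa [e2 _ _ (by omega) (by omega)], e4, e5, e3⟩
    · refine .inr ⟨i, j, k, hij, hfull', by rwa [e2 _ _ (by omega) (by omega)], by simp, e4,
        by rwa [e2 _ _ (by omega) (by omega)], e5, e3, fun a b ha hb hb' => ?_⟩
      rw [e2 _ _ (by omega) (by omega)]
      exact hc3 a b ha hb hb'

theorem Move.mem_IDPlus_iff {z : Perm (Fin n)} (h : Move D E) : D ∈ IDPlus z ↔ E ∈ IDPlus z := by
  obtain ⟨i, j, k, hij, hfull, h1, h2, h3, hc, rfl⟩ := move_iff.1 h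
  by_cases hE : E ⊆ upperTriangle n
  · obtain ⟨e1, e2, -⟩ := foldl_act_drop hE hij hfull h1 h2 hc
    exact (mem_IDPlus_congr hE (insert_subset_upperTriangle hE hij hfull h1) e1 (e2 h3)).symm
  -- Outside the triangle neither set is a pipe dream: since `i < j`, the antidiagonal of `(i, k +
  -- 1)` is at most that of `(j, k)`, so `D` in the triangle would force `E` into it.
  · refine iff_of_false (fun hD => hE ?_) fun hE' => hE (InvPipeDream.mem_IDPlus_iff.1 hE').1
    have hD := (InvPipeDream.mem_IDPlus_iff.1 hD).1
    intro c hcE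
    by_cases h : c = (i, k + 1)
    · subst h
      have : j + k + 2 ≤ n := hD (Set.mem_insert _ _)
      change i + (k + 1) + 2 ≤ n
      omega
    · exact hD (Set.mem_insert_of_mem _ ⟨hcE, h⟩)

open Classical in
/-- The sum of the row indices of the cells of `E` in the `n × n` matrix. -/
noncomputable def weight (n : ℕ) (E : Set (ℕ × ℕ)) : ℕ :=
  ∑ c ∈ (Finset.range n ×ˢ Finset.range n).filter (· ∈ E), c.1

-- A cell passes from row `j` to a row `i < j`. Since the weight is bounded for fixed `n`, chains of
-- inverse moves terminate; strictness also yields antisymmetry of the order on `IDPlus z`.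
open Classical in
theorem Move.weight_lt (h : Move D E) (hE : E ⊆ upperTriangle n) : weight n E < weight n D := by
  obtain ⟨i, j, k, hij, hfull, h1, h2, h3, hc, rfl⟩ := move_iff.1 h
  have hjn := drop_lt hE hij hfull h1
  have e1 : weight n (insert (j, k) (E \ {(i, k + 1)})) = ∑ c ∈ insert (j, k)
      (((Finset.range n ×ˢ Finset.range n).filter (· ∈ E)).erase (i, k + 1)), c.1 := by
    unfold weight
    congr 1
    ext c
    by_cases hc1 : c = (j, k)
    · subst hc1; simp; omega
    · simp [hc1]; tauto
  have hm : (i, k + 1) ∈ (Finset.range n ×ˢ Finset.range n).filter (· ∈ E) := by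
    have : i + (k + 1) + 2 ≤ n := hE h1
    simp [h1]; omega
  rw [e1, weight, Finset.sum_insert (by simp [h3]), ← Finset.add_sum_erase _ _ hm]
  simpa using hij

/-! ### The involution code -/

/-- The involution code of a permutation of `ℕ`. -/
noncomputable def icode (y : Perm ℕ) (i : ℕ) : ℕ := {j | i < j ∧ y j < y i ∧ y j ≤ i}.ncard

/-- The substitution `v = y j` counts values instead of positions. The counted numbers are then at
most `i`, out of reach of letters larger than `i`. -/
theorem icode_eq {y : Perm ℕ} (hy : y⁻¹ = y) (i : ℕ) :
    icode y i = {v | v ≤ i ∧ i < y v ∧ v < y i}.ncard := by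
  rw [icode, ← Set.ncard_image_of_injective _ y.injective]
  congr 1
  ext v
  simp only [Set.mem_image, Set.mem_ofPred_eq]
  constructor
  · rintro ⟨j, ⟨h1, h2, h3⟩, rfl⟩
    rw [invol_apply hy]
    exact ⟨h3, h1, h2⟩
  · rintro ⟨h1, h2, h3⟩
    exact ⟨y v, by rw [invol_apply hy]; exact ⟨h2, h3, h1⟩, invol_apply hy v⟩

/-- In the form of `icode_eq`, the images `y v` and `y i` are only compared with numbers at most
`i`, and such comparisons are unaffected by the exchange of `a` and `a + 1` for `a > i`. -/
theorem icode_act {y : Perm ℕ} (hy : y⁻¹ = y) {i a : ℕ} (h : i < a) :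
    icode (act y a) i = icode y i := by
  rw [icode_eq hy, icode_eq (act_inv hy a)]
  congr 1
  ext v
  simp only [Set.mem_ofPred_eq]
  refine and_congr_right fun hv => ?_
  have hva : adj a v = v := adj_of_ne (by omega) (by omega)
  have hia : adj a i = i := adj_of_ne (by omega) (by omega)
  by_cases hlt : y a < y (a + 1)
  · by_cases hfix : y a = a ∧ y (a + 1) = a + 1
    · rw [act_of_fixed hy hfix.1 hfix.2, Perm.mul_apply, Perm.mul_apply, hva, hia]
    · rw [act_of_lt hy hlt hfix, Perm.mul_apply, Perm.mul_apply, Perm.mul_apply, Perm.mul_apply,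
        hva, hia]
      simp only [adj_apply]
      split_ifs <;> omega
  · rw [act_of_not_lt hy hlt]

theorem icode_foldl_act {y : Perm ℕ} (hy : y⁻¹ = y) {i : ℕ} {w : List ℕ} (h : ∀ x ∈ w, i < x) :
    icode (w.foldl act y) i = icode y i := by
  induction w generalizing y with
  | nil => rfl
  | cons x w ih =>
    rw [List.foldl_cons, ih (act_inv hy x) fun z hz => h z (by simp [hz]),
      icode_act hy (h x (by simp))]

/-! ### Words of left-justified sets of cells -/

/-- The word `i + c - 1, …, i + 1, i`. -/
def desc (i : ℕ) : ℕ → List ℕ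
  | 0 => []
  | c + 1 => (i + c) :: desc i c

theorem mem_desc {i c x : ℕ} : x ∈ desc i c ↔ i ≤ x ∧ x < i + c := by
  induction c with
  | zero => simp [desc]
  | succ c ih => rw [desc, List.mem_cons, ih]; omega

theorem desc_succ (i c : ℕ) : desc i (c + 1) = desc (i + 1) c ++ [i] := by
  induction c with
  | zero => simp [desc]
  | succ c ih => rw [desc, ih, desc, List.cons_append]; congr 1; ring

/-- The word of the left-justified set of cells with `c r` cells in row `r`, for `r < i`. -/
def codeWord (c : ℕ → ℕ) : ℕ → List ℕ
  | 0 => []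
  | i + 1 => codeWord c i ++ desc i (c i)

theorem codeWord_congr {c d : ℕ → ℕ} {i : ℕ} (h : ∀ r < i, c r = d r) :
    codeWord c i = codeWord d i := by
  induction i with
  | zero => rfl
  | succ i ih => rw [codeWord, codeWord, ih fun r hr => h r (by omega), h i (by omega)]

theorem letters_rowCells {i c m : ℕ} (h : ∀ j, (i, j) ∈ E ↔ j < c) (hc : c ≤ m) :
    letters E (rowCells i m) = desc i c := by
  induction m generalizing c with
  | zero => obtain rfl : c = 0 := by omega
            rfl
  | succ m ih =>
    rcases Nat.lt_or_ge m c with hm | hm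
    · obtain rfl : c = m + 1 := by omega
      rw [rowCells, letters_cons_of_mem ((h m).2 hm), desc]
      congr 1
      have : letters E (rowCells i m) = letters {x | x.2 < m} (rowCells i m) := by
        refine letters_congr fun x hx => ?_
        obtain ⟨rfl, hx⟩ := mem_rowCells.1 hx
        rw [h, Set.mem_ofPred_eq]
        omega
      rw [this]
      clear this ih h hc hm
      have : ∀ k ≤ m, letters {x | x.2 < m} (rowCells i k) = desc i k := by
        intro k hk
        induction k with
        | zero => rfl
        | succ k ihk =>
          rw [rowCells, letters_cons_of_mem (by simpa using hk), desc, ihk (by omega)]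
      exact this m le_rfl
    · rw [rowCells, letters_cons_of_notMem (by rw [h]; omega), ih h hm]

theorem letters_rowsCells {c : ℕ → ℕ} {i : ℕ} (h : ∀ r < i, ∀ j, (r, j) ∈ E ↔ j < c r)
    (hc : ∀ r < i, c r ≤ n) : letters E (rowsCells n 0 i) = codeWord c i := by
  induction i with
  | zero => rfl
  | succ i ih =>
    rw [rowsCells, letters_append, ih (fun r hr => h r (by omega)) fun r hr => hc r (by omega),
      zero_add, letters_rowCells (h i (by omega)) (hc i (by omega)), codeWord]

/-! ### Involutions generated by the rows above a given row -/

/-- The involutions `y` whose code vanishes from row `i` on: the points `i, …, p - 1` are matched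
with smaller points than `i`, in an increasing way, and the points from `p` on are fixed. -/
structure Upper (i p : ℕ) (y : Perm ℕ) : Prop where
  invol : y⁻¹ = y
  le : i ≤ p
  lt : ∀ r, i ≤ r → r < p → y r < i
  mono : ∀ r r', i ≤ r → r < r' → r' < p → y r < y r'
  fix : ∀ r, p ≤ r → y r = r

/-- An intermediate stage in the addition of a row of cells to `y`: the point `g` is exceptional,
and its image compares with the images of `r` as if it were placed after `q`. -/
structure Carry (i g q p : ℕ) (y : Perm ℕ) : Prop where
  invol : y⁻¹ = y
  le : i ≤ g
  le' : g ≤ q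
  lt : q < p
  low : ∀ r, i ≤ r → r < p → r ≠ g → y r < i ∨ y r = g
  mono : ∀ r r', i ≤ r → r < r' → r' < p → r ≠ g → r' ≠ g → y r < y r'
  below : ∀ r, i ≤ r → r ≤ q → r ≠ g → y r < y g
  above : ∀ r, q < r → r < p → y g < y r
  fix : ∀ r, p ≤ r → y r = r

/-- Conjugation by `s_g` brings the exceptional point from `g + 1` to `g` and passes the image of
`g` on to `g + 1`. The order of the other images and the threshold `q` survive. Once the exceptional
point is `i`, the points after it with smaller image are those up to `q`, so the code at `i` is `q -
i`. -/
theorem Carry.step {i g q p : ℕ} {y : Perm ℕ} (h : Carry i (g + 1) q p y) (hg : i ≤ g) :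
    y g < y (g + 1) ∧ Carry i g q p (act y g) := by
  have hlt := h.below g hg (by have := h.le'; omega) (by omega)
  have hle' := h.le'
  have hlt' := h.lt
  have hy := invol_apply h.invol
  have hg1 : y g < i := by
    refine (h.low g hg (by omega) (by omega)).resolve_right fun h1 => ?_
    have := hy g
    rw [h1] at this
    omega
  have hX : y (g + 1) ≠ g := fun h1 => by
    have := hy (g + 1)
    rw [h1] at this
    omega
  have hact : ∀ r, act y g r = adj g (y (adj g r)) := fun r => by
    rw [act_of_lt h.invol hlt (by omega)]; rfl
  have v1 : act y g g = adj g (y (g + 1)) := by rw [hact, adj_left]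
  have v2 : act y g (g + 1) = y g := by rw [hact, adj_right, adj_of_ne] <;> omega
  have v3 : ∀ r, r ≠ g → r ≠ g + 1 → act y g r = adj g (y r) := fun r h1 h2 => by
    rw [hact, adj_of_ne h1 h2]
  refine ⟨hlt, act_inv h.invol g, hg, by omega, hlt', fun r h1 h2 h3 => ?_,
    fun r r' h1 h2 h3 h4 h5 => ?_, fun r h1 h2 h3 => ?_, fun r h1 h2 => ?_, fun r h1 => ?_⟩
  · by_cases hr : r = g + 1
    · subst hr; omega
    · rw [v3 r h3 hr, adj_apply]
      have := h.low r h1 h2 hr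
      split_ifs <;> omega
  · by_cases hr : r = g + 1
    · subst hr
      rw [v2, v3 r' h5 (by omega), adj_apply]
      have := h.mono g r' hg (by omega) h3 (by omega) (by omega)
      split_ifs <;> omega
    · by_cases hr' : r' = g + 1
      · subst hr'
        rw [v2, v3 r h4 hr, adj_apply]
        have := h.mono r g h1 (by omega) (by omega) hr (by omega)
        split_ifs <;> omega
      · rw [v3 r h4 hr, v3 r' h5 hr', adj_apply, adj_apply]
        have := h.mono r r' h1 h2 h3 hr hr'
        have := h.low r h1 (by omega) hr
        have := h.low r' (by omega) h3 hr'
        split_ifs <;> omega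
  · by_cases hr : r = g + 1
    · subst hr
      rw [v2, v1, adj_apply]
      split_ifs <;> omega
    · rw [v3 r h3 hr, v1, adj_apply, adj_apply]
      have := h.below r h1 h2 hr
      have := h.low r h1 (by omega) hr
      split_ifs <;> omega
  · rw [v1, v3 r (by omega) (by omega), adj_apply, adj_apply]
    have := h.above r h1 h2
    have := h.low r (by omega) h2 (by omega)
    have hr : y r ≠ g + 1 := fun h3 => by
      have h4 := hy r
      rw [h3] at h4
      omega
    split_ifs <;> omega
  · rw [v3 r (by omega) (by omega), h.fix r h1, adj_of_ne] <;> omega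

theorem Carry.foldl {i d q p : ℕ} {y : Perm ℕ} (h : Carry i (i + d) q p y) :
    Ascending y (desc i d) ∧ Carry i i q p ((desc i d).foldl act y) := by
  induction d generalizing y with
  | zero => exact ⟨trivial, h⟩
  | succ d ih =>
    obtain ⟨h1, h2⟩ := h.step (Nat.le_add_right i d)
    obtain ⟨h3, h4⟩ := ih h2
    exact ⟨⟨h1, h3⟩, h4⟩

theorem Carry.upper {i q p : ℕ} {y : Perm ℕ} (h : Carry i i q p y) :
    Upper (i + 1) p y ∧ icode y i = q - i := by
  have hlt := h.lt
  have hle := h.le'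
  refine ⟨⟨h.invol, by omega, fun r h1 h2 => ?_, fun r r' h1 h2 h3 => ?_, h.fix⟩, ?_⟩
  · have := h.low r (by omega) h2 (by omega)
    omega
  · exact h.mono r r' (by omega) h2 h3 (by omega) (by omega)
  · have : {j | i < j ∧ y j < y i ∧ y j ≤ i} = (Finset.Ioc i q : Set ℕ) := by
      ext j
      simp only [Set.mem_ofPred_eq, Finset.coe_Ioc, Set.mem_Ioc]
      constructor
      · rintro ⟨h1, h2, h3⟩
        refine ⟨h1, ?_⟩
        by_contra hj
        rcases Nat.lt_or_ge j p with hp | hp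
        · have := h.above j (by omega) hp
          omega
        · have := h.fix j hp
          omega
      · rintro ⟨h1, h2⟩
        have := h.low j (by omega) (by omega) (by omega)
        exact ⟨h1, h.below j (by omega) h2 (by omega), by omega⟩
    rw [icode, this, Set.ncard_coe_finset, Nat.card_Ioc]

/-- The effect of a left-justified row of cells of moderate length. -/
theorem Upper.row {i p c : ℕ} {y : Perm ℕ} (h : Upper i p y) (hc : i + c ≤ p + 1) :
    Ascending y (desc i c) ∧ Upper (i + 1) (max p (i + c + 1)) ((desc i c).foldl act y) ∧
      icode ((desc i c).foldl act y) i = c := by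
  have hle := h.le
  -- If `i + c = p + 1`, the first letter `p` exchanges the fixed points `p` and `p + 1`; this new
  -- pair starts the carry, with `p` exceptional and threshold `p + 1`. Otherwise the carry starts
  -- from `y` itself with `i + c` as exceptional point, possibly the fixed point `p`.
  rcases Nat.lt_or_ge p (i + c) with hpc | hpc
  · obtain ⟨d, rfl⟩ : ∃ d, c = d + 1 := ⟨c - 1, by omega⟩
    obtain rfl : p = i + d := by omega
    have hp0 := h.fix (i + d) le_rfl
    have hp1 := h.fix (i + d + 1) (by omega)
    have hact : ∀ r, act y (i + d) r = y (adj (i + d) r) := fun r => by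
      rw [act_of_fixed h.invol hp0 hp1]; rfl
    have v0 : act y (i + d) (i + d) = i + d + 1 := by rw [hact, adj_left, hp1]
    have v1 : act y (i + d) (i + d + 1) = i + d := by rw [hact, adj_right, hp0]
    have v2 : ∀ r, r ≠ i + d → r ≠ i + d + 1 → act y (i + d) r = y r := fun r h1 h2 => by
      rw [hact, adj_of_ne h1 h2]
    have hC : Carry i (i + d) (i + d + 1) (i + d + 2) (act y (i + d)) := by
      refine ⟨act_inv h.invol _, by omega, by omega, by omega, fun r h1 h2 h3 => ?_,
        fun r r' h1 h2 h3 h4 h5 => ?_, fun r h1 h2 h3 => ?_, fun r h1 h2 => by omega,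
        fun r h1 => ?_⟩
      · by_cases hr : r = i + d + 1
        · subst hr; exact .inr v1
        · rw [v2 r h3 hr]; exact .inl (h.lt r h1 (by omega))
      · by_cases hr : r' = i + d + 1
        · subst hr
          rw [v1, v2 r h4 (by omega)]
          have := h.lt r h1 (by omega)
          omega
        · rw [v2 r h4 (by omega), v2 r' h5 hr]
          exact h.mono r r' h1 h2 (by omega)
      · by_cases hr : r = i + d + 1
        · subst hr; omega
        · rw [v0, v2 r h3 hr]
          have := h.lt r h1 (by omega)
          omega
      · rw [v2 r (by omega) (by omega), h.fix r (by omega)]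
    obtain ⟨h1, h2⟩ := hC.foldl
    obtain ⟨h3, h4⟩ := h2.upper
    rw [show max (i + d) (i + (d + 1) + 1) = i + d + 2 by omega]
    refine ⟨⟨show y (i + d) < y (i + d + 1) by omega, h1⟩, h3, ?_⟩
    rw [desc, List.foldl_cons, h4]
    omega
  · have hC : Carry i (i + c) (i + c) (max p (i + c + 1)) y := by
      have hq : i + c = p → y (i + c) = i + c := fun h1 => h.fix _ h1.ge
      refine ⟨h.invol, by omega, le_rfl, by omega, fun r h1 h2 h3 => .inl (h.lt r h1 (by omega)),
        fun r r' h1 h2 h3 h4 h5 => h.mono r r' h1 h2 (by omega), fun r h1 h2 h3 => ?_,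
        fun r h1 h2 => h.mono _ _ (by omega) h1 (by omega), fun r h1 => h.fix r (by omega)⟩
      rcases eq_or_lt_of_le hpc with hp | hp
      · rw [hq hp]
        have := h.lt r h1 (by omega)
        omega
      · exact h.mono r _ h1 (by omega) hp
    obtain ⟨h1, h2⟩ := hC.foldl
    obtain ⟨h3, h4⟩ := h2.upper
    exact ⟨h1, h3, by rw [h4]; omega⟩

/-- This undoes a row: the exceptional point is pushed back from `g` to its threshold `q`, where it
takes its place in the increasing order. The exceptions are that it is fixed, or that it is matched
with its right neighbour. -/
theorem Carry.exists_upper {i g q p : ℕ} {y : Perm ℕ} (h : Carry i g q p y) :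
    ∃ p' y', Upper i p' y' ∧ q ≤ p' + 1 ∧ (desc g (q - g)).foldl act y' = y := by
  have hy := invol_apply h.invol
  induction hd : q - g generalizing g y with
  | zero =>
    have hle' := h.le'
    have hle := h.le
    have hlt := h.lt
    obtain rfl : g = q := by omega
    -- A fixed exceptional point must be the last one before `p`, and the new bound is then `g`
    -- instead of `p`.
    by_cases hX : y g = g
    · have hp : p = g + 1 := by
        by_contra hp
        have h1 := h.above (g + 1) (by omega) (by omega)
        have h2 := h.low (g + 1) (by omega) (by omega) (by omega)
        omega
      refine ⟨g, y, ⟨h.invol, h.le, fun r h1 h2 => ?_, fun r r' h1 h2 h3 => ?_, fun r h1 => ?_⟩,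
        by omega, rfl⟩
      · have h3 := h.low r h1 (by omega) (by omega)
        have h4 := h.below r h1 (by omega) (by omega)
        omega
      · exact h.mono r r' h1 h2 (by omega) (by omega) (by omega)
      · rcases eq_or_lt_of_le h1 with rfl | h1
        · exact hX
        · exact h.fix r (by omega)
    · have hlow : ∀ r, i ≤ r → r < p → r ≠ g → y r < i := fun r h1 h2 h3 => by
        refine (h.low r h1 h2 h3).resolve_right fun h4 => ?_
        have h5 := hy r
        rw [h4] at h5
        rcases Nat.lt_or_ge r g with hr | hr
        · have := h.below r h1 (by omega) h3
          omega
        · have := h.above r (by omega) h2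
          omega
      have hX' : y g < i := by
        by_contra hc
        rcases Nat.lt_or_ge (y g) p with hp | hp
        · have := hlow (y g) (by omega) hp hX
          rw [hy] at this
          omega
        · have := h.fix _ hp
          rw [hy] at this
          omega
      refine ⟨p, y, ⟨h.invol, by omega, fun r h1 h2 => ?_, fun r r' h1 h2 h3 => ?_, h.fix⟩,
        by omega, rfl⟩
      · by_cases hr : r = g
        · rwa [hr]
        · exact hlow r h1 h2 hr
      · by_cases hr : r = g
        · subst hr; exact h.above r' h2 h3
        · by_cases hr' : r' = g
          · subst hr'; exact h.below r h1 (by omega) hr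
          · exact h.mono r r' h1 h2 h3 hr hr'
  | succ d ih =>
    have hle := h.le
    have hlt := h.lt
    have hgt := h.below (g + 1) (by omega) (by omega) (by omega)
    rw [desc_succ]
    simp only [List.foldl_append, List.foldl_cons, List.foldl_nil]
    -- The exceptional point is next to its partner. This forces `p = g + 2` and `q = g + 1`, so
    -- only one letter remains; undoing it makes both points fixed.
    by_cases hX : y g = g + 1
    · have hX' : y (g + 1) = g := by rw [← hX, hy]
      have hp : p = g + 2 := by
        by_contra hp
        have h1 := h.low (g + 2) (by omega) (by omega) (by omega)
        have h2 := h.mono (g + 1) (g + 2) (by omega) (by omega) (by omega) (by omega) (by omega)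
        have h3 : y (g + 2) ≠ g := fun h3 => by
          have := hy (g + 2)
          rw [h3] at this
          omega
        omega
      have hd0 : d = 0 := by omega
      subst hd0
      have v0 : (y * adj g) g = g := by simp [hX']
      have v1 : (y * adj g) (g + 1) = g + 1 := by simp [hX]
      have v2 : ∀ r, r ≠ g → r ≠ g + 1 → (y * adj g) r = y r := fun r h1 h2 => by
        rw [Perm.mul_apply, adj_of_ne h1 h2]
      have hinv : (y * adj g)⁻¹ = y * adj g := by
        rw [mul_inv_rev, h.invol, adj_inv, conj_adj, hX, hX', swap_comm, adj]
      have hlow : ∀ r, i ≤ r → r < g → y r < i := fun r h1 h2 => by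
        refine (h.low r h1 (by omega) (by omega)).resolve_right fun h4 => ?_
        have h5 := hy r
        rw [h4] at h5
        omega
      refine ⟨g, y * adj g, ⟨hinv, hle, fun r h1 h2 => ?_, fun r r' h1 h2 h3 => ?_,
        fun r h1 => ?_⟩, by omega, ?_⟩
      · rw [v2 r (by omega) (by omega)]
        exact hlow r h1 h2
      · rw [v2 r (by omega) (by omega), v2 r' (by omega) (by omega)]
        exact h.mono r r' h1 h2 (by omega) (by omega) (by omega)
      · rcases eq_or_ne r g with rfl | hr
        · exact v0
        rcases eq_or_ne r (g + 1) with rfl | hr'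
        · exact v1
        · rw [v2 r hr hr', h.fix r (by omega)]
      · rw [desc, List.foldl_nil, act_of_fixed hinv v0 v1, mul_assoc, adj_mul_self, mul_one]
    · have hg1 : y (g + 1) < i := by
        refine (h.low (g + 1) (by omega) (by omega) (by omega)).resolve_right fun h1 => hX ?_
        have h2 := hy (g + 1)
        rwa [h1] at h2
      have hinv : (adj g * y * adj g)⁻¹ = adj g * y * adj g := by
        rw [mul_inv_rev, mul_inv_rev, h.invol, adj_inv, mul_assoc]
      have hval : ∀ r, (adj g * y * adj g) r = adj g (y (adj g r)) := fun r => rfl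
      have v0 : (adj g * y * adj g) g = y (g + 1) := by
        rw [hval, adj_left, adj_of_ne] <;> omega
      have v1 : (adj g * y * adj g) (g + 1) = adj g (y g) := by rw [hval, adj_right]
      have v2 : ∀ r, r ≠ g → r ≠ g + 1 → (adj g * y * adj g) r = adj g (y r) :=
        fun r h1 h2 => by rw [hval, adj_of_ne h1 h2]
      have hasc : (adj g * y * adj g) g < (adj g * y * adj g) (g + 1) := by
        rw [v0, v1, adj_apply]
        split_ifs <;> omega
      have hback : act (adj g * y * adj g) g = y := by
        rw [act_of_lt hinv hasc (by rw [v0]; omega)]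
        simp [mul_assoc]
        simp [← mul_assoc]
      have hC : Carry i (g + 1) q p (adj g * y * adj g) := by
        refine ⟨hinv, by omega, by omega, hlt, fun r h1 h2 h3 => ?_,
          fun r r' h1 h2 h3 h4 h5 => ?_, fun r h1 h2 h3 => ?_, fun r h1 h2 => ?_, fun r h1 => ?_⟩
        · by_cases hr : r = g
          · subst hr; rw [v0]; omega
          · rw [v2 r hr h3, adj_apply]
            have := h.low r h1 h2 hr
            split_ifs <;> omega
        · by_cases hr : r = g
          · subst hr
            rw [v0, v2 r' (by omega) h5, adj_apply]
            have := h.mono (r + 1) r' (by omega) (by omega) h3 (by omega) (by omega)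
            split_ifs <;> omega
          · by_cases hr' : r' = g
            · subst hr'
              rw [v0, v2 r hr h4, adj_apply]
              have := h.mono r (r' + 1) h1 (by omega) (by omega) hr (by omega)
              split_ifs <;> omega
            · rw [v2 r hr h4, v2 r' hr' h5, adj_apply, adj_apply]
              have := h.mono r r' h1 h2 h3 hr hr'
              have := h.low r h1 (by omega) hr
              have := h.low r' (by omega) h3 hr'
              split_ifs <;> omega
        · by_cases hr : r = g
          · subst hr; exact hasc
          · rw [v2 r hr h3, v1, adj_apply, adj_apply]
            have := h.below r h1 h2 hr
            have := h.low r h1 (by omega) hr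
            split_ifs <;> omega
        · rw [v1, v2 r (by omega) (by omega), adj_apply, adj_apply]
          have := h.above r h1 h2
          have := h.low r (by omega) h2 (by omega)
          have hr : y r ≠ g := fun h3 => by
            have h4 := hy r
            rw [h3] at h4
            omega
          split_ifs <;> omega
        · rw [v2 r (by omega) (by omega), h.fix r h1, adj_of_ne] <;> omega
      obtain ⟨p', y', hU, hq, hf⟩ := ih hC (invol_apply hinv) (by omega)
      exact ⟨p', y', hU, hq, by rw [hf, hback]⟩

/-- The images of `i + 1, …, p - 1` increase, so those below `y i` belong to an initial segment. The
threshold `q` is its last point, or `i` if it is empty. -/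
theorem Upper.exists_carry {i p : ℕ} {y : Perm ℕ} (h : Upper (i + 1) p y) :
    ∃ q, Carry i i q p y := by
  classical
  have hle := h.le
  set q := Nat.findGreatest (fun r => r = i ∨ (i < r ∧ y r < y i)) (p - 1) with hq
  have hqle : q ≤ p - 1 := Nat.findGreatest_le _
  have hqi : i ≤ q := Nat.le_findGreatest (by omega) (.inl rfl)
  have hspec : q = i ∨ (i < q ∧ y q < y i) :=
    Nat.findGreatest_spec (P := fun r => r = i ∨ (i < r ∧ y r < y i)) (m := i) (by omega) (.inl rfl)
  refine ⟨q, h.invol, le_rfl, hqi, by omega, fun r h1 h2 h3 => ?_,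
    fun r r' h1 h2 h3 h4 h5 => h.mono r r' (by omega) h2 h3, fun r h1 h2 h3 => ?_,
    fun r h1 h2 => ?_, h.fix⟩
  · have := h.lt r (by omega) h2
    omega
  · rcases eq_or_lt_of_le h2 with h4 | h4
    · rw [h4]; omega
    · have := h.mono r q (by omega) h4 (by omega)
      omega
  · have := Nat.findGreatest_is_greatest (P := fun r => r = i ∨ (i < r ∧ y r < y i)) h1 (by omega)
    have hne : y r ≠ y i := fun h3 => by
      have := y.injective h3
      omega
    omega

/-- An involution can be recovered from its code. -/
theorem Upper.codeWord {i p : ℕ} {y : Perm ℕ} (h : Upper i p y) :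
    Ascending 1 (codeWord (icode y) i) ∧ (codeWord (icode y) i).foldl act 1 = y := by
  induction i generalizing p y with
  | zero =>
    refine ⟨trivial, ?_⟩
    ext m
    rcases Nat.lt_or_ge m p with hm | hm
    · have := h.lt m (by omega) hm
      omega
    · rw [h.fix m hm]; rfl
  | succ i ih =>
    obtain ⟨q, hC⟩ := h.exists_carry
    obtain ⟨p', y', hU, hq, hf⟩ := hC.exists_upper
    have hq' := hC.le'
    obtain ⟨h1, -, h3⟩ := hU.row (c := q - i) (by omega)
    obtain ⟨ih1, ih2⟩ := ih hU
    have hcode : ∀ r < i, icode y r = icode y' r := fun r hr => by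
      rw [← hf, icode_foldl_act hU.invol]
      intro x hx
      have := mem_desc.1 hx
      omega
    rw [hf] at h3
    rw [InvPipeDream.codeWord, codeWord_congr hcode, h3, ascending_append, List.foldl_append, ih2]
    exact ⟨⟨ih1, h1⟩, hf⟩

/-- The first point fixed by the involution of a code and all of whose successors are fixed. -/
def bound (c : ℕ → ℕ) : ℕ → ℕ
  | 0 => 0
  | i + 1 => max (bound c i) (i + c i + 1)

theorem lt_bound (c : ℕ → ℕ) {a i : ℕ} (h : a < i) : a + c a < bound c i := by
  induction i with
  | zero => omega
  | succ i ih =>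
    rw [bound]
    rcases Nat.lt_succ_iff_lt_or_eq.1 h with h | rfl
    · have := ih h
      omega
    · omega

theorem le_bound (c : ℕ → ℕ) (i : ℕ) : i ≤ bound c i := by
  cases i with
  | zero => omega
  | succ i => rw [bound]; omega

/-- The hypothesis is the one that `Upper.row` needs at each row, `bound c r` being the point from
which everything is fixed. A row `r` creates the code `c r`, and later rows, having only letters
larger than `r`, do not alter it. -/
theorem upper_codeWord {c : ℕ → ℕ} {i : ℕ} (h : ∀ r < i, r + c r ≤ bound c r + 1) :
    Upper i (bound c i) ((codeWord c i).foldl act 1) ∧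
      ∀ r < i, icode ((codeWord c i).foldl act 1) r = c r := by
  induction i with
  | zero =>
    refine ⟨⟨inv_one, le_rfl, fun r _ h => ?_, fun r r' _ _ h => ?_, fun _ _ => rfl⟩, ?_⟩
    · simp [bound] at h
    · simp [bound] at h
    · simp
  | succ i ih =>
    obtain ⟨h1, h2⟩ := ih fun r hr => h r (by omega)
    obtain ⟨-, h3, h4⟩ := h1.row (h i (by omega))
    rw [codeWord, List.foldl_append]
    refine ⟨h3, fun r hr => ?_⟩
    rcases Nat.lt_succ_iff_lt_or_eq.1 hr with hr | rfl
    · rw [icode_foldl_act h1.invol, h2 r hr]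
      intro x hx
      have := mem_desc.1 hx
      omega
    · exact h4

/-! ### The bottom involution pipe dream -/

theorem invCode_eq (z : Perm (Fin n)) (i : Fin n) : invCode z i = icode (ext z) i := by
  rw [invCode, icode, ← Set.ncard_coe_finset, ← Set.ncard_image_of_injective _ Fin.val_injective]
  congr 1
  ext j
  simp only [Finset.coe_filter, Finset.mem_univ, true_and, Set.mem_image, Set.mem_ofPred_eq]
  constructor
  · rintro ⟨j, h, rfl⟩
    rw [ext_val, ext_val]
    exact h
  · rintro ⟨h1, h2, h3⟩
    have hj : j < n := by
      by_contra hj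
      rw [fixesFrom_ext z j (by omega)] at h3
      omega
    rw [ext_mk z hj, ext_val] at h2
    rw [ext_mk z hj] at h3
    exact ⟨⟨j, hj⟩, ⟨h1, h2, h3⟩, rfl⟩

theorem icode_le {y : Perm ℕ} (hy : FixesFrom n y) {i : ℕ} (hi : i < n) :
    i + icode y i + 1 ≤ n := by
  have hsub : {j | i < j ∧ y j < y i ∧ y j ≤ i} ⊆ (Finset.Ioo i n : Set ℕ) := by
    rintro j ⟨h1, h2, h3⟩
    simp only [Finset.coe_Ioo, Set.mem_Ioo]
    refine ⟨h1, ?_⟩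
    by_contra hj
    rw [hy j (by omega)] at h3
    omega
  have := Set.ncard_le_ncard hsub (Finset.finite_toSet _)
  rw [Set.ncard_coe_finset, Nat.card_Ioo] at this
  rw [icode]
  omega

theorem mem_bottom {z : Perm (Fin n)} {i j : ℕ} :
    (i, j) ∈ bottom z ↔ i < n ∧ j < icode (ext z) i := by
  constructor
  · rintro ⟨i, j, h, hj⟩
    simp only [Prod.mk.injEq] at h
    obtain ⟨rfl, rfl⟩ := h
    rw [invCode_eq] at hj
    exact ⟨i.2, hj⟩
  · rintro ⟨hi, hj⟩
    have := icode_le (fixesFrom_ext z) hi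
    exact ⟨⟨i, hi⟩, ⟨j, by omega⟩, rfl, by rw [invCode_eq]; exact hj⟩

theorem bottom_subset (z : Perm (Fin n)) : bottom z ⊆ upperTriangle n := by
  rintro ⟨i, j⟩ h
  obtain ⟨hi, hj⟩ := mem_bottom.1 h
  have := icode_le (fixesFrom_ext z) hi
  change i + j + 2 ≤ n
  omega

theorem ext_inv {z : Perm (Fin n)} (hz : z⁻¹ = z) : (ext z)⁻¹ = ext z := by rw [← map_inv, hz]

theorem bottom_mem_IDPlus {z : Perm (Fin n)} (hz : z⁻¹ = z) : bottom z ∈ IDPlus z := by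
  -- For `i = p = n` the conditions on points between `i` and `p` are vacuous.
  have hU : Upper n n (ext z) := ⟨ext_inv hz, le_rfl, fun r h1 h2 => by omega,
    fun r r' h1 h2 h3 => by omega, fixesFrom_ext z⟩
  have hw : word n (bottom z) = codeWord (icode (ext z)) n :=
    letters_rowsCells (fun r hr j => by rw [mem_bottom]; simp [hr]) fun r hr => by
      have := icode_le (fixesFrom_ext z) hr
      omega
  rw [mem_IDPlus_iff, hw]
  exact ⟨bottom_subset z, hU.codeWord.2, hU.codeWord.1⟩

/-! ### Elements without inverse moves, and descent to the bottom -/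

/-- An element of `ℐ𝒟⁺(z)` to which no inverse ladder move can be applied is the bottom one. -/
theorem eq_bottom {z : Perm (Fin n)} (hE : E ∈ IDPlus z) (hmin : ∀ D, ¬Move D E) :
    E = bottom z := by
  classical
  obtain ⟨hEn, hfold, -⟩ := mem_IDPlus_iff.1 hE
  -- The cell would drop to the first row below `i` where columns `k` and `k + 1` are not both
  -- occupied. As the rows below `i` are left-justified, column `k + 1` is empty there.
  have key : ∀ i k, (∀ r, i < r → ∀ l, (r, l + 1) ∈ E → (r, l) ∈ E) → (i, k + 1) ∈ E →
      ¬CanDrop E i k := by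
    intro i k hLJ h1 hc
    have hex : ∃ j, i < j ∧ ¬((j, k) ∈ E ∧ (j, k + 1) ∈ E) := by
      refine ⟨i + n + 1, by omega, fun h => ?_⟩
      have : i + n + 1 + k + 2 ≤ n := hEn h.1
      omega
    obtain ⟨hij, hj⟩ := Nat.find_spec hex
    have hfull : ∀ r, i < r → r < Nat.find hex → (r, k) ∈ E ∧ (r, k + 1) ∈ E := fun r hr hr' => by
      have := Nat.find_min hex hr'
      tauto
    have h2 : (Nat.find hex, k + 1) ∉ E := fun h => hj ⟨hLJ _ hij k h, h⟩
    exact hmin _ (move_iff.2 ⟨i, _, k, hij, hfull, h1, h2,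
      notMem_of_canDrop hE hij hfull h1 h2 hc, hc, rfl⟩)
  -- Left justification is proved from the lowest row upwards, since `key` needs it for the rows
  -- below.
  have hLJ : ∀ d i, n ≤ i + d → ∀ k, (i, k + 1) ∈ E → (i, k) ∈ E := by
    intro d
    induction d with
    | zero =>
      intro i hi k h
      have : i + (k + 1) + 2 ≤ n := hEn h
      omega
    | succ d ih =>
      intro i hi k h
      by_contra hc
      exact key i k (fun r hr => ih r (by omega)) h (.inl hc)
  have hLJ : ∀ i k, (i, k + 1) ∈ E → (i, k) ∈ E := fun i => hLJ n i (by omega)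
  have hex : ∀ i, ∃ j, (i, j) ∉ E := fun i => ⟨n, fun h => by
    have : i + n + 2 ≤ n := hEn h
    omega⟩
  set c : ℕ → ℕ := fun i => Nat.find (hex i) with hc
  have hcE : ∀ i j, (i, j) ∈ E ↔ j < c i := fun i j => by
    constructor
    · intro h
      by_contra hj
      have : ∀ m, c i ≤ m → (i, m) ∉ E := fun m hm => by
        induction m, hm using Nat.le_induction with
        | base => exact Nat.find_spec (hex i)
        | succ m _ ih => exact fun h => ih (hLJ i m h)
      exact this j (by omega) h
    · intro h
      have := Nat.find_min (hex i) h
      tauto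
  -- In a row violating the bound, the last cell `(i, k + 1)` has `(i, k)` to its left, and all
  -- earlier rows end on antidiagonals before `i + k - 1`; so an inverse involution move is
  -- possible.
  have hbound : ∀ i < n, i + c i ≤ bound c i + 1 := by
    intro i _
    by_contra hlt
    have hle := le_bound c i
    obtain ⟨k, hk⟩ : ∃ k, c i = k + 2 := ⟨c i - 2, by omega⟩
    refine key i k (fun r _ => hLJ r) ((hcE _ _).2 (by omega)) (.inr ⟨(hcE _ _).2 (by omega),
      fun h => ?_, fun a b ha hb hb' h => ?_⟩)
    · have := (hcE _ _).1 h
      omega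
    · have := (hcE _ _).1 h
      have := lt_bound c ha
      omega
  have hw : word n E = codeWord c n := letters_rowsCells (fun r _ => hcE r) fun r _ => by
    by_contra h
    have : r + n + 2 ≤ n := hEn ((hcE r n).2 (by omega))
    omega
  have hcode := (upper_codeWord hbound).2
  rw [← hw, hfold] at hcode
  ext ⟨i, j⟩
  rw [mem_bottom, hcE]
  constructor
  · intro h
    have : i + j + 2 ≤ n := hEn ((hcE i j).2 h)
    rw [hcode i (by omega)]
    exact ⟨by omega, h⟩
  · rintro ⟨hi, h⟩
    rwa [hcode i hi] at h

open Classical in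
theorem weight_le (n : ℕ) (E : Set (ℕ × ℕ)) : weight n E ≤ weight n Set.univ :=
  Finset.sum_le_sum_of_subset fun c hc => by simp at hc ⊢; exact hc.1

/-- Inverse moves stay in `IDPlus z`, raise a bounded weight, and can only stop at the bottom
element. -/
theorem invLE_of_mem {z : Perm (Fin n)} (hE : E ∈ IDPlus z) : InvLE (bottom z) E := by
  induction hw : weight n Set.univ - weight n E using Nat.strong_induction_on generalizing E with
  | _ m ih =>
    by_cases hmin : ∀ D, ¬Move D E
    · rw [eq_bottom hE hmin]
      exact .refl
    · push Not at hmin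
      obtain ⟨D, hD⟩ := hmin
      have h1 := hD.weight_lt (mem_IDPlus_iff.1 hE).1
      have h2 := weight_le n D
      exact (ih _ (by omega) (hD.mem_IDPlus_iff.2 hE) rfl).tail hD

theorem InvLE.mem_IDPlus_iff {z : Perm (Fin n)} (h : InvLE D E) :
    D ∈ IDPlus z ↔ E ∈ IDPlus z := by
  induction h with
  | refl => rfl
  | tail _ h ih => exact ih.trans h.mem_IDPlus_iff

theorem InvLE.weight_le (h : InvLE D E) {z : Perm (Fin n)} (hE : E ∈ IDPlus z) :
    weight n E ≤ weight n D ∧ (weight n E = weight n D → D = E) := by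
  induction h with
  | refl => simp
  | tail _ h ih =>
    have h1 := h.weight_lt (InvPipeDream.mem_IDPlus_iff.1 hE).1
    have h2 := ih (h.mem_IDPlus_iff.2 hE)
    omega

/-! ### Almost-symmetric pipe dreams -/

/-- The cells weakly below the main diagonal, in reading order. -/
def lowerCells (n : ℕ) : List (ℕ × ℕ) := (rowsCells n 0 n).filter fun c => c.2 ≤ c.1

theorem mem_lowerCells {c : ℕ × ℕ} : c ∈ lowerCells n ↔ c ∈ lowerTriangle n := by
  rw [lowerCells, List.mem_filter, mem_rowsCells, lowerTriangle, Set.mem_ofPred_eq,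
    decide_eq_true_eq]
  omega

theorem lowerCells_pairwise (n : ℕ) :
    (lowerCells n).Pairwise fun c c' => c.1 < c'.1 ∨ (c.1 = c'.1 ∧ c'.2 < c.2) :=
  (rowsCells_pairwise n 0 n).filter _

theorem word_eq_lowerCells (hE : E ⊆ lowerTriangle n) :
    word n E = letters E (lowerCells n) := by
  rw [word, lowerCells, letters, letters, List.filter_filter]
  congr 1
  refine List.filter_congr fun c _ => ?_
  by_cases hc : c ∈ E
  · have : c.2 ≤ c.1 := (hE hc).2
    simp [hc, this]
  · simp [hc]

/-- The transposes of the strictly lower cells of a list, in the opposite order. -/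
def upperCells (X : List (ℕ × ℕ)) : List (ℕ × ℕ) :=
  ((X.filter fun c => c.2 < c.1).reverse).map Prod.swap

theorem upperCells_append (X Y : List (ℕ × ℕ)) :
    upperCells (X ++ Y) = upperCells Y ++ upperCells X := by simp [upperCells]

theorem upperCells_singleton_of_lt {c : ℕ × ℕ} (h : c.2 < c.1) : upperCells [c] = [c.swap] := by
  simp [upperCells, h]

theorem upperCells_singleton_of_not_lt {c : ℕ × ℕ} (h : ¬c.2 < c.1) : upperCells [c] = [] := by
  simp [upperCells, h]

theorem mem_upperCells {X : List (ℕ × ℕ)} {c : ℕ × ℕ} :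
    c ∈ upperCells X ↔ c.swap ∈ X ∧ c.1 < c.2 := by
  simp only [upperCells, List.mem_map, List.mem_reverse, List.mem_filter, decide_eq_true_eq]
  constructor
  · rintro ⟨x, h, rfl⟩
    simpa using h
  · intro h
    exact ⟨c.swap, by simpa using h, by simp⟩

/-- The reading order of the `n × n` matrix which is symmetric outside the main diagonal. -/
theorem isReading_symmetric (n : ℕ) : IsReading n (upperCells (lowerCells n) ++ lowerCells n) where
  pairwise := by
    rw [List.pairwise_append]
    refine ⟨?_, (lowerCells_pairwise n).imp fun h => by omega, fun c hc c' hc' => ?_⟩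
    · rw [upperCells, List.pairwise_map, List.pairwise_reverse]
      refine ((lowerCells_pairwise n).filter _).imp fun h => ?_
      simp only [Prod.fst_swap, Prod.snd_swap]
      omega
    · have h1 := (mem_upperCells.1 hc).2
      have h2 : c'.2 ≤ c'.1 := (mem_lowerCells.1 hc').2
      omega
  mem_iff c := by
    rw [List.mem_append, mem_upperCells, mem_lowerCells, mem_lowerCells, lowerTriangle,
      Set.mem_ofPred_eq, Set.mem_ofPred_eq, Prod.fst_swap, Prod.snd_swap]
    omega

theorem symmetric_split {X U : List (ℕ × ℕ)} {c : ℕ × ℕ} (h : lowerCells n = X ++ c :: U) :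
    IsReading n (upperCells U ++ upperCells [c] ++ upperCells X ++ X ++ c :: U) := by
  have := isReading_symmetric n
  rw [h, upperCells_append, ← List.singleton_append, upperCells_append] at this
  simpa using this

/-- The involution reached after reading a list of cells of `E`. -/
noncomputable def reached (E : Set (ℕ × ℕ)) (X : List (ℕ × ℕ)) : Perm ℕ :=
  (letters E X).foldl act 1

theorem reached_inv (E : Set (ℕ × ℕ)) (X : List (ℕ × ℕ)) : (reached E X)⁻¹ = reached E X :=
  foldl_act_inv inv_one _

theorem reached_append_of_mem {c : ℕ × ℕ} (hc : c ∈ E) (X : List (ℕ × ℕ)) :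
    reached E (X ++ [c]) = act (reached E X) (c.1 + c.2) := by
  rw [reached, letters_append, letters_cons_of_mem hc, List.foldl_append]; rfl

theorem reached_append_of_notMem {c : ℕ × ℕ} (hc : c ∉ E) (X : List (ℕ × ℕ)) :
    reached E (X ++ [c]) = reached E X := by
  rw [reached, letters_append, letters_cons_of_notMem hc, letters_nil, List.append_nil, reached]

theorem fixesFrom_reached (hE : E ⊆ upperTriangle n) (X : List (ℕ × ℕ)) :
    FixesFrom n (reached E X) := (FixesFrom.one n).foldl_act (letters_bound hE X)

/-- The cell is diagonal and thus the first of its row among the lower cells. All cells read before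
lie in earlier rows, and their letters are at most `c.1 + c.2 - 2`. -/
theorem reached_diag {X U : List (ℕ × ℕ)} {c : ℕ × ℕ} (h : lowerCells n = X ++ c :: U)
    (hc : ¬c.2 < c.1) {m : ℕ} (hm : c.1 + c.2 ≤ m) : reached E X m = m := by
  refine foldl_act_fixed rfl fun l hl => ?_
  obtain ⟨x, hx, _, rfl⟩ := mem_letters.1 hl
  have hp := lowerCells_pairwise n
  have h1 : x.2 ≤ x.1 := (mem_lowerCells.1 (by rw [h]; simp [hx] : x ∈ lowerCells n)).2
  have h2 : c.2 ≤ c.1 := (mem_lowerCells.1 (by rw [h]; simp : c ∈ lowerCells n)).2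
  rw [h, List.pairwise_append] at hp
  have := hp.2.2 x hx c (by simp)
  omega

/-- The two points exchanged in the next step are fixed by the involution reached so far. -/
def Commutes (E : Set (ℕ × ℕ)) (X : List (ℕ × ℕ)) (c : ℕ × ℕ) : Prop :=
  reached E X (c.1 + c.2) = c.1 + c.2 ∧ reached E X (c.1 + c.2 + 1) = c.1 + c.2 + 1

theorem symmetric_cons {X : List (ℕ × ℕ)} {c : ℕ × ℕ} :
    letters D (upperCells (X ++ [c]) ++ (X ++ [c])) =
      letters D (upperCells [c]) ++ letters D (upperCells X ++ X) ++ letters D [c] := by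
  rw [upperCells_append]
  simp

/-- Put `x = c.1 + c.2`. The pipes through `c` arrive at the positions `x` and `x + 1`. Between
there and the transposed cell, positions are permuted by `s_x` and then by the involution reached so
far. The two pairs of pipes agree iff this involution preserves `{x, x + 1}`, and being increasing
on this pair, it then fixes both points. -/
theorem commutes_iff_passesThrough (hD : D ⊆ upperTriangle n) {X U : List (ℕ × ℕ)} {c : ℕ × ℕ}
    (h : lowerCells n = X ++ c :: U) (hc : c.2 < c.1) (hcD : c ∈ D)
    (hX : prodAdj (letters D (upperCells X ++ X)) = reached E X)
    (hlt : reached E X (c.1 + c.2) < reached E X (c.1 + c.2 + 1)) :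
    Commutes E X c ↔ ∀ p : Fin n, PassesThrough D p c ↔ PassesThrough D p c.swap := by
  have hcn : c.1 + c.2 + 2 ≤ n := hD hcD
  have hL := symmetric_split h
  have hL' : IsReading n (upperCells U ++ c.swap :: (upperCells X ++ X ++ c :: U)) := by
    rw [upperCells_singleton_of_lt hc] at hL
    simpa using hL
  set u := prodAdj (letters D U) with hu
  have hfu : FixesFrom n u := FixesFrom.prodAdj (letters_bound hD U)
  have hp : ∀ p : Fin n, (PassesThrough D p c ↔ PassesThrough D p c.swap) ↔
      ((u p = c.1 + c.2 ∨ u p = c.1 + c.2 + 1) ↔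
      (reached E X (adj (c.1 + c.2) (u p)) = c.1 + c.2 ∨
        reached E X (adj (c.1 + c.2) (u p)) = c.1 + c.2 + 1)) := by
    intro p
    rw [passesThrough_iff hD hL, passesThrough_iff hD hL', letters_append,
      letters_cons_of_mem hcD, prodAdj_append, prodAdj_cons, hX, ← hu, Perm.mul_apply,
      Perm.mul_apply, Prod.fst_swap, Prod.snd_swap, add_comm c.2 c.1]
  simp only [hp]
  constructor
  · rintro ⟨h1, h2⟩ p
    have e1 : ∀ m, reached E X m = c.1 + c.2 ↔ m = c.1 + c.2 := fun m => by
      nth_rewrite 1 [← h1]; exact (reached E X).injective.eq_iff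
    have e2 : ∀ m, reached E X m = c.1 + c.2 + 1 ↔ m = c.1 + c.2 + 1 := fun m => by
      nth_rewrite 1 [← h2]; exact (reached E X).injective.eq_iff
    rw [e1, e2, adj_eq_left_iff, adj_eq_right_iff, or_comm]
  · intro h
    have h1 := (h ⟨u⁻¹ (c.1 + c.2), hfu.inv.lt (by omega)⟩).1 (.inl (by simp))
    have h2 := (h ⟨u⁻¹ (c.1 + c.2 + 1), hfu.inv.lt (by omega)⟩).1 (.inr (by simp))
    have e : ∀ m, u (u⁻¹ m) = m := fun m => by simp
    simp only [e, adj_left, adj_right] at h1 h2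
    rw [Commutes]
    omega

/-- Reading a set of cells together with the transposes of the noncommuting ones. -/
theorem reached_eq_prodAdj (hE : E ⊆ upperTriangle n)
    (hDE : ∀ c ∈ lowerCells n, c ∈ D ↔ c ∈ E)
    (hstep : ∀ X c U, lowerCells n = X ++ c :: U → c.2 < c.1 →
      (c.swap ∈ D ↔ c ∈ E ∧ ¬Commutes E X c))
    (hA : Ascending 1 (letters E (lowerCells n))) {X U : List (ℕ × ℕ)}
    (h : lowerCells n = X ++ U) :
    prodAdj (letters D (upperCells X ++ X)) = reached E X ∧
      invNum n (reached E X) = (letters D (upperCells X ++ X)).length := by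
  induction X using List.reverseRecOn generalizing U with
  | nil => simp [upperCells, reached, invNum_one]
  | append_singleton X c ih =>
    rw [List.append_assoc, List.singleton_append] at h
    obtain ⟨ih1, ih2⟩ := ih h
    have hcl : c ∈ lowerCells n := by rw [h]; simp
    rw [symmetric_cons, prodAdj_append, prodAdj_append, List.length_append, List.length_append,
      ih1, ← ih2]
    have hinv := reached_inv E X
    by_cases hcE : c ∈ E
    · have hcn : c.1 + c.2 + 2 ≤ n := hE hcE
      have hlt : reached E X (c.1 + c.2) < reached E X (c.1 + c.2 + 1) := by
        rw [h, letters_append, letters_cons_of_mem hcE, ascending_append] at hA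
        exact hA.2.1
      rw [reached_append_of_mem hcE, letters_cons_of_mem ((hDE c hcl).2 hcE), letters_nil]
      -- If the two points are fixed, the involution changes by one right factor and the transpose
      -- is absent from `D`. Otherwise it is conjugated, and the transpose supplies the left factor.
      -- Diagonal cells always fall under the first case.
      by_cases hcomm : Commutes E X c
      · have hup : letters D (upperCells [c]) = [] := by
          by_cases hc : c.2 < c.1
          · rw [upperCells_singleton_of_lt hc, letters_cons_of_notMem, letters_nil]
            rw [hstep X c U h hc]
            tauto
          · rw [upperCells_singleton_of_not_lt hc, letters_nil]
        rw [hup, act_of_fixed hinv hcomm.1 hcomm.2, invNum_mul_adj (by omega) hlt]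
        simp [add_comm]
      · have hc : c.2 < c.1 := by
          by_contra hc
          exact hcomm ⟨reached_diag h hc le_rfl, reached_diag h hc (by omega)⟩
        rw [upperCells_singleton_of_lt hc,
          letters_cons_of_mem ((hstep X c U h hc).2 ⟨hcE, hcomm⟩), letters_nil,
          act_of_lt hinv hlt hcomm, invNum_act hinv (fixesFrom_reached hE X) (by omega) hlt hcomm]
        simp [add_comm]
        omega
    · have hup : letters D (upperCells [c]) = [] := by
        by_cases hc : c.2 < c.1
        · rw [upperCells_singleton_of_lt hc, letters_cons_of_notMem, letters_nil]
          rw [hstep X c U h hc]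
          tauto
        · rw [upperCells_singleton_of_not_lt hc, letters_nil]
      rw [reached_append_of_notMem hcE, hup,
        letters_cons_of_notMem (fun hc => hcE ((hDE c hcl).1 hc)), letters_nil]
      simp

theorem exists_almostSymmetric {z : Perm (Fin n)} (hE : E ∈ IDPlus z)
    (hEl : E ⊆ lowerTriangle n) : E ∈ ID z := by
  classical
  obtain ⟨hEn, hfold, hA⟩ := mem_IDPlus_iff.1 hE
  rw [word_eq_lowerCells hEl] at hfold hA
  have hbefore : ∀ X c U, lowerCells n = X ++ c :: U →
      (lowerCells n).takeWhile (fun x => x ≠ c) = X := by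
    intro X c U h
    have hnd : c ∉ X := fun hc => by
      have hp := lowerCells_pairwise n
      rw [h, List.pairwise_append] at hp
      have := hp.2.2 c hc c (by simp)
      omega
    rw [h, List.takeWhile_append_of_pos, List.takeWhile_cons_of_neg (by simp), List.append_nil]
    intro x hx
    simp only [ne_eq, decide_not, Bool.not_eq_eq_eq_not, Bool.not_true, decide_eq_false_iff_not]
    rintro rfl
    exact hnd hx
  -- The transposes of exactly those cells whose letter acts by a proper conjugation are added. The
  -- `takeWhile` recovers the cells read before a given one.
  set D : Set (ℕ × ℕ) := E ∪ {d | d.1 < d.2 ∧ d.swap ∈ E ∧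
    ¬Commutes E ((lowerCells n).takeWhile (fun x => x ≠ d.swap)) d.swap} with hDdef
  have hlow : ∀ c, ¬c.1 < c.2 → (c ∈ D ↔ c ∈ E) := fun c hc => by simp [hDdef, hc]
  have hupE : ∀ c : ℕ × ℕ, c.1 < c.2 → c ∉ E := fun c hc h => by
    have : c.2 ≤ c.1 := (hEl h).2
    omega
  have hDE : ∀ c ∈ lowerCells n, c ∈ D ↔ c ∈ E := fun c hc => hlow c (by
    have : c.2 ≤ c.1 := (mem_lowerCells.1 hc).2
    omega)
  have hD : D ⊆ upperTriangle n := by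
    rintro c (hc | ⟨-, hc, -⟩)
    · exact hEn hc
    · have : c.2 + c.1 + 2 ≤ n := hEn hc
      change c.1 + c.2 + 2 ≤ n
      omega
  have hstep : ∀ X c U, lowerCells n = X ++ c :: U → c.2 < c.1 →
      (c.swap ∈ D ↔ c ∈ E ∧ ¬Commutes E X c) := by
    intro X c U h hc
    have h1 : c.swap ∉ E := hupE _ hc
    rw [hDdef, Set.mem_union, Set.mem_ofPred_eq, Prod.swap_swap, hbefore X c U h, Prod.fst_swap,
      Prod.snd_swap]
    tauto
  have key := fun X U => @reached_eq_prodAdj n D E hEn hDE hstep hA X U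
  have hz : reached E (lowerCells n) = ext z := hfold
  have hfull := key (lowerCells n) [] (by simp)
  rw [hz] at hfull
  refine ⟨D, (mem_PD_iff (isReading_symmetric n)).2 ⟨hD, hfull.1, hfull.2⟩, ⟨fun i j hij h => ?_,
    fun i j hij h1 h2 => ?_⟩, ?_⟩
  · rcases h with h | h
    · exact absurd h (hupE _ hij)
    · exact .inl h.2.1
  · have hE1 : (j, i) ∈ E := (hlow _ (by simp only; omega)).1 h1
    obtain ⟨X, U, h⟩ := List.append_of_mem (mem_lowerCells.2 (hEl hE1))
    have hlt : reached E X (j + i) < reached E X (j + i + 1) := by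
      rw [h, letters_append, letters_cons_of_mem hE1, ascending_append] at hA
      exact hA.2.1
    refine (commutes_iff_passesThrough hD h hij h1 (key X _ h).1 hlt).1 ?_
    by_contra hcomm
    exact h2 ((hstep X _ U h hij).2 ⟨hE1, hcomm⟩)
  · ext c
    constructor
    · exact fun hc => ⟨.inl hc, hEl hc⟩
    · rintro ⟨hc, hc'⟩
      exact (hDE c (mem_lowerCells.2 hc')).1 hc

/-- A prefix `X` of the lower cells and its transposes form a contiguous factor of the symmetric
reading order, so their word is reduced. Reducedness makes every letter an ascent of the involution
reached, and almost-symmetry decides whether a letter acts on one side or on both. -/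
theorem mem_IDPlus_of_almostSymmetric {z : Perm (Fin n)} (hDz : D ∈ PD z)
    (hsym : IsAlmostSymmetric n D) : D ∩ lowerTriangle n ∈ IDPlus z := by
  obtain ⟨hD, hprod, hlen⟩ := (mem_PD_iff (isReading_symmetric n)).1 hDz
  rw [← hprod] at hlen
  set E := D ∩ lowerTriangle n with hEdef
  have hEn : E ⊆ upperTriangle n := fun c hc => hD hc.1
  have hDE : ∀ c ∈ lowerCells n, c ∈ D ↔ c ∈ E := fun c hc => by
    simp [hEdef, mem_lowerCells.1 hc]
  have key : ∀ X U, lowerCells n = X ++ U →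
      prodAdj (letters D (upperCells X ++ X)) = reached E X ∧ Ascending 1 (letters E X) := by
    intro X
    induction X using List.reverseRecOn with
    | nil => intro U _; simp [upperCells, reached, Ascending]
    | append_singleton X c ih =>
      intro U h
      have hred : invNum n (prodAdj (letters D (upperCells (X ++ [c]) ++ (X ++ [c])))) =
          (letters D (upperCells (X ++ [c]) ++ (X ++ [c]))).length := by
        have e : letters D (upperCells (lowerCells n) ++ lowerCells n) =
            letters D (upperCells U) ++ letters D (upperCells (X ++ [c]) ++ (X ++ [c])) ++
              letters D U := by
          rw [h, upperCells_append]
          simp only [letters_append, List.append_assoc]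
        have hb := letters_bound hD (upperCells (lowerCells n) ++ lowerCells n)
        rw [e] at hb hlen
        exact invNum_prodAdj_infix hb hlen
      rw [List.append_assoc, List.singleton_append] at h
      obtain ⟨ih1, ih2⟩ := ih _ h
      have hcl : c ∈ lowerCells n := by rw [h]; simp
      have hinv := reached_inv E X
      by_cases hcD : c ∈ D
      · have hcE := (hDE c hcl).1 hcD
        have hcn : c.1 + c.2 + 2 ≤ n := hD hcD
        have hb := letters_bound hD (upperCells (X ++ [c]) ++ (X ++ [c]))
        have hlt : reached E X (c.1 + c.2) < reached E X (c.1 + c.2 + 1) := by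
          rw [symmetric_cons] at hred hb
          have h1 := invNum_prodAdj_infix (a := letters D (upperCells [c]))
            (b := letters D (upperCells X ++ X) ++ letters D [c]) (c := []) (by simpa using hb)
            (by simpa using hred)
          have h2 := invNum_prodAdj_infix hb hred
          rw [ih1] at h2
          rw [prodAdj_append, ih1, letters_cons_of_mem hcD, letters_nil, prodAdj_cons, prodAdj_nil,
            mul_one, List.length_append] at h1
          refine lt_of_invNum_mul_adj (n := n) (i := c.1 + c.2) (by omega) ?_
          rw [h1, h2]
          simp
        have hA : Ascending 1 (letters E (X ++ [c])) := by
          rw [letters_append, letters_cons_of_mem hcE, ascending_append]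
          exact ⟨ih2, hlt, trivial⟩
        refine ⟨?_, hA⟩
        rw [symmetric_cons] at hred ⊢
        rw [reached_append_of_mem hcE]
        rw [prodAdj_append, prodAdj_append, ih1, letters_cons_of_mem hcD, letters_nil] at hred ⊢
        by_cases hc : c.2 < c.1
        · rw [upperCells_singleton_of_lt hc] at hred ⊢
          by_cases hcs : c.swap ∈ D
          · rw [letters_cons_of_mem hcs, letters_nil, Prod.fst_swap, Prod.snd_swap,
              add_comm c.2 c.1] at hred ⊢
            rw [act_of_lt hinv hlt]
            · simp
            -- If the two points were fixed, the factors from `c` and its transpose would cancel,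
            -- and the word would not be reduced.
            · intro hcomm
              have hX := invNum_prodAdj_le (letters_bound hD (upperCells X ++ X))
              have e : adj (c.1 + c.2) * reached E X * adj (c.1 + c.2) = reached E X := by
                rw [mul_assoc, conj_adj, hcomm.1, hcomm.2, ← mul_assoc, ← adj, adj_mul_self,
                  one_mul]
              simp only [prodAdj_cons, prodAdj_nil, mul_one, e] at hred
              rw [ih1] at hX
              simp only [List.length_append, List.length_cons, List.length_nil] at hred
              omega
          · have hcomm := (commutes_iff_passesThrough hD h hc hcD ih1 hlt).2
              (hsym.2 c.2 c.1 hc hcD hcs)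
            rw [letters_cons_of_notMem hcs, letters_nil, act_of_fixed hinv hcomm.1 hcomm.2]
            simp
        · rw [upperCells_singleton_of_not_lt hc, letters_nil, act_of_fixed hinv
            (reached_diag h hc le_rfl) (reached_diag h hc (by omega))]
          simp
      · have hcE : c ∉ E := fun hc => hcD hc.1
        have hup : letters D (upperCells [c]) = [] := by
          by_cases hc : c.2 < c.1
          · rw [upperCells_singleton_of_lt hc, letters_cons_of_notMem, letters_nil]
            exact fun hcs => hcD (hsym.1 c.2 c.1 hc hcs)
          · rw [upperCells_singleton_of_not_lt hc, letters_nil]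
        have hEX : letters E (X ++ [c]) = letters E X := by
          rw [letters_append, letters_cons_of_notMem hcE, letters_nil, List.append_nil]
        rw [symmetric_cons, hup, reached_append_of_notMem hcE, hEX, letters_cons_of_notMem hcD,
          letters_nil, List.nil_append, List.append_nil]
        exact ⟨ih1, ih2⟩
  obtain ⟨h1, h2⟩ := key (lowerCells n) [] (by simp)
  rw [mem_IDPlus_iff, word_eq_lowerCells Set.inter_subset_right]
  exact ⟨hEn, h1.symm.trans hprod, h2⟩

theorem mem_ID_iff {z : Perm (Fin n)} :
    E ∈ ID z ↔ E ⊆ lowerTriangle n ∧ E ∈ IDPlus z := by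
  constructor
  · rintro ⟨D, hD, hsym, rfl⟩
    exact ⟨Set.inter_subset_right, mem_IDPlus_of_almostSymmetric hD hsym⟩
  · rintro ⟨h1, h2⟩
    exact exists_almostSymmetric h2 h1

/-! ### The main theorem -/

theorem mem_IDPlus_iff_of_eqvGen {z : Perm (Fin n)} (h : Relation.EqvGen Move D E) :
    D ∈ IDPlus z ↔ E ∈ IDPlus z := by
  induction h with
  | rel _ _ h => exact h.mem_IDPlus_iff
  | refl => rfl
  | symm _ _ _ ih => exact ih.symm
  | trans _ _ _ _ _ ih ih' => exact ih.trans ih'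

theorem mem_IDPlus_iff_invLE {z : Perm (Fin n)} (hz : z⁻¹ = z) :
    E ∈ IDPlus z ↔ InvLE (bottom z) E :=
  ⟨invLE_of_mem, fun h => h.mem_IDPlus_iff.1 (bottom_mem_IDPlus hz)⟩

theorem mem_IDPlus_iff_symmGen {z : Perm (Fin n)} (hz : z⁻¹ = z) :
    E ∈ IDPlus z ↔ Relation.SymmGen InvLE (bottom z) E := by
  refine ⟨fun h => .inl (invLE_of_mem h), ?_⟩
  rintro (h | h)
  · exact h.mem_IDPlus_iff.1 (bottom_mem_IDPlus hz)
  · exact h.mem_IDPlus_iff.2 (bottom_mem_IDPlus hz)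

theorem mem_IDPlus_iff_eqvGen {z : Perm (Fin n)} (hz : z⁻¹ = z) :
    E ∈ IDPlus z ↔ Relation.EqvGen Move (bottom z) E := by
  refine ⟨fun h => ?_, fun h => (mem_IDPlus_iff_of_eqvGen h).1 (bottom_mem_IDPlus hz)⟩
  have h' := invLE_of_mem h
  clear h
  induction h' with
  | refl => exact .refl _
  | tail _ h ih => exact .trans _ _ _ ih (.rel _ _ h)

theorem isLeast_iff_eq_bottom {z : Perm (Fin n)} (hz : z⁻¹ = z) (M : Set (ℕ × ℕ)) :
    (M ∈ IDPlus z ∧ ∀ E ∈ IDPlus z, InvLE M E) ↔ M = bottom z := by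
  constructor
  · rintro ⟨hM, h⟩
    have h1 := (h _ (bottom_mem_IDPlus hz)).weight_le (bottom_mem_IDPlus hz)
    have h2 := (invLE_of_mem hM).weight_le hM
    exact h1.2 (le_antisymm h1.1 h2.1)
  · rintro rfl
    exact ⟨bottom_mem_IDPlus hz, fun E => invLE_of_mem⟩

end InvPipeDream

theorem theorem5p8 (n : ℕ) (z : Equiv.Perm (Fin n)) (hz : z⁻¹ = z) :
    -- the reduced pipe dreams of atoms of `z`
    (InvPipeDream.IDPlus z = {E | InvPipeDream.InvLE (InvPipeDream.bottom z) E} ∧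
      InvPipeDream.IDPlus z =
        {E | Relation.SymmGen InvPipeDream.InvLE (InvPipeDream.bottom z) E} ∧
      InvPipeDream.IDPlus z =
        {E | Relation.EqvGen InvPipeDream.Move (InvPipeDream.bottom z) E}) ∧
    -- upper and lower set
    (∀ D E : Set (ℕ × ℕ), InvPipeDream.InvLE D E →
      (D ∈ InvPipeDream.IDPlus z ↔ E ∈ InvPipeDream.IDPlus z)) ∧
    -- unique minimum
    (∀ M : Set (ℕ × ℕ),
      (M ∈ InvPipeDream.IDPlus z ∧ ∀ E ∈ InvPipeDream.IDPlus z, InvPipeDream.InvLE M E) ↔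
        M = InvPipeDream.bottom z) ∧
    -- the involution pipe dreams of `z`
    (InvPipeDream.ID z =
        {E | E ⊆ InvPipeDream.lowerTriangle n ∧
          InvPipeDream.InvLE (InvPipeDream.bottom z) E} ∧
      InvPipeDream.ID z =
        {E | E ⊆ InvPipeDream.lowerTriangle n ∧
          Relation.SymmGen InvPipeDream.InvLE (InvPipeDream.bottom z) E} ∧
      InvPipeDream.ID z =
        {E | E ⊆ InvPipeDream.lowerTriangle n ∧
          Relation.EqvGen InvPipeDream.Move (InvPipeDream.bottom z) E}) := by
  open InvPipeDream in
  refine ⟨⟨?_, ?_, ?_⟩, fun D E h => h.mem_IDPlus_iff, isLeast_iff_eq_bottom hz, ?_, ?_, ?_⟩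
  · exact Set.ext fun E => mem_IDPlus_iff_invLE hz
  · exact Set.ext fun E => mem_IDPlus_iff_symmGen hz
  · exact Set.ext fun E => mem_IDPlus_iff_eqvGen hz
  · exact Set.ext fun E => mem_ID_iff.trans
      (and_congr_right fun _ => mem_IDPlus_iff_invLE hz)
  · exact Set.ext fun E => mem_ID_iff.trans
      (and_congr_right fun _ => mem_IDPlus_iff_symmGen hz)
  · exact Set.ext fun E => mem_ID_iff.trans
      (and_congr_right fun _ => mem_IDPlus_iff_eqvGen hz)
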